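/- Let $k$ be an algebraically closed field of arbitrary characteristic, let $X$ be an irreducible smooth proper curve over $k$ of genus $g\geq 2$, and fix a point $\infty\in X(k)$. Let $J$ be the jacobian of $X$, so that $J(k)=\mathrm{Pic}^0(X)$ is the group of divisors of degree zero modulo principal divisors, and embed $X$ in $J$ by sending $\xi$ to the class of $[\xi]-[\infty]$. For $N\geq 1$ let $J[N]$ be the group of points of $J(k)$ of order dividing $N$, and put $X[N]=X\cap J[N]$. Let $0=\delta_1<\delta_2<\cdots$ be the increasing sequence of orders of poles at $\infty$ of the non-zero functions in $\mathcal{O}_X(X-\{\infty\})$, and set $d=\delta_2$. Let $x\in k(X)$ be any function which is regular away from $\infty$ and has a pole of order $d$ at $\infty$, let $\pi:X\to\mathbb{P}^1$ be the morphism defined by $x$, let $e_\xi$ be the ramification index of $\pi$ at $\xi$ (the order of vanishing at $\xi$ of $x-x(\xi)$ if $\xi\neq\infty$, and of $1/x$ if $\xi=\infty$), and let $\mathcal{R}$ be the set of points where $\pi$ is ramified, i.e. where $e_\xi\geq 2$. Then $$X[d]=\{\xi\in\mathcal{R}\mid e_\xi=d\}.$$ Furthermore, $X[d]$ is finite and $$\#X[d]\leq\frac{2(g+d-1)}{d-1}.$$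 -/

import Mathlib

open AlgebraicGeometry CategoryTheory

/-- An irreducible smooth proper curve over a field `k`. A smooth `k`-scheme is reduced, so
irreducible is the same as integral here. -/
structure SmoothProperCurve (k : Type*) [Field k] where
  X : Scheme
  str : X ⟶ Spec (.of k)
  isIntegral : IsIntegral X
  isProper : IsProper str
  smooth : SmoothOfRelativeDimension 1 str

namespace SmoothProperCurve

attribute [instance] isIntegral isProper smooth

noncomputable section

variable {k : Type*} [Field k] (C : SmoothProperCurve k)

instance isLocallyNoetherian : IsLocallyNoetherian C.X :=
  LocallyOfFiniteType.isLocallyNoetherian C.str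

instance nonemptyTop : Nonempty (⊤ : C.X.Opens) := ⟨⟨genericPoint C.X, trivial⟩⟩

/-- The closed points of `X`. When `k` is algebraically closed these are the `k`-rational points
(see `AlgebraicGeometry.pointEquivClosedPoint`). -/
abbrev Point : Type _ := closedPoints C.X

/-- The function field `k(X)`. -/
abbrev FunctionField : Type _ := C.X.functionField

/-- The inclusion of the constants `k → Γ(X, 𝒪_X) → k(X)`. -/
def constHom : k →+* C.FunctionField :=
  (C.X.germToFunctionField ⊤).hom.comp
    (C.str.appTop.hom.comp (Scheme.ΓSpecIso (.of k)).inv.hom)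

instance algebraFunctionField : Algebra k C.FunctionField := C.constHom.toAlgebra

/-- `f` is regular at `P`: it lies in the local ring `𝒪_{X,P} ⊆ k(X)`. -/
def IsRegularAt (P : C.Point) (f : C.FunctionField) : Prop :=
  f ∈ (algebraMap (C.X.presheaf.stalk P.1) C.FunctionField).range

/-- `f` is regular at `P` with value `f(P) = c`: the function `f - c` lies in the maximal ideal of
the local ring `𝒪_{X,P}`. -/
def HasValueAt (P : C.Point) (f : C.FunctionField) (c : k) : Prop :=
  ∃ a ∈ IsLocalRing.maximalIdeal (C.X.presheaf.stalk P.1),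
    algebraMap (C.X.presheaf.stalk P.1) C.FunctionField a = f - algebraMap k C.FunctionField c

/-- The normalized discrete valuation `v_P(f)`: the order of vanishing of `f` at `P`,
with `v_P(0) = 0` by convention. -/
def ordAt (P : C.Point) (f : C.FunctionField) : ℤ := Scheme.ord f P.1

/-! ### The genus -/

lemma isRegularAt_algebraMap (P : C.Point) (c : k) :
    C.IsRegularAt P (algebraMap k C.FunctionField c) :=
  ⟨C.X.presheaf.germ ⊤ P.1 trivial (C.str.appTop.hom ((Scheme.ΓSpecIso (.of k)).inv.hom c)),
    Scheme.algebraMap_germ_eq_germToFunctionField C.X _ _⟩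

/-- The local ring `𝒪_{X,P}`, as a `k`-subspace of `k(X)`. -/
def localRing (P : C.Point) : Submodule k C.FunctionField where
  carrier := {f | C.IsRegularAt P f}
  add_mem' := Subring.add_mem (algebraMap (C.X.presheaf.stalk P.1) C.FunctionField).range
  zero_mem' := Subring.zero_mem (algebraMap (C.X.presheaf.stalk P.1) C.FunctionField).range
  smul_mem' c f hf := by
    simp only [Algebra.smul_def]
    exact Subring.mul_mem _ (C.isRegularAt_algebraMap P c) hf

/-- The space `R` of répartitions: families `(a_P)` of rational functions indexed by the closed
points, with `a_P` regular at `P` for all but finitely many `P`. -/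
def repartitions : Submodule k (C.Point → C.FunctionField) where
  carrier := {a | {P | a P ∉ C.localRing P}.Finite}
  add_mem' {a b} ha hb := (ha.union hb).subset fun P hP => by
    by_contra h
    simp only [Set.mem_union, Set.mem_ofPred_eq, not_or, not_not] at h
    exact hP ((C.localRing P).add_mem h.1 h.2)
  zero_mem' := by simp
  smul_mem' c a ha := Set.Finite.subset ha fun P hP h => hP ((C.localRing P).smul_mem c h)

/-- The space `R(0)` of everywhere regular répartitions. -/
def regularRepartitions : Submodule k (C.Point → C.FunctionField) where
  carrier := {a | ∀ P, a P ∈ C.localRing P}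
  add_mem' ha hb P := (C.localRing P).add_mem (ha P) (hb P)
  zero_mem' P := (C.localRing P).zero_mem
  smul_mem' c _ ha P := (C.localRing P).smul_mem c (ha P)

/-- The constant families, i.e. `k(X)` embedded diagonally. -/
def principalRepartitions : Submodule k (C.Point → C.FunctionField) :=
  LinearMap.range (LinearMap.pi fun _ : C.Point => (LinearMap.id : C.FunctionField →ₗ[k] _))

/-- The cohomology group `H¹(X, 𝒪_X) = R / (R(0) + k(X))`, that is, the cokernel of
`k(X) → ⨁_P k(X) / 𝒪_{X,P}`, computed by means of the flasque resolution
`0 → 𝒪_X → k(X) → ⨁_P k(X) / 𝒪_{X,P} → 0`. -/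
abbrev H1 : Type _ :=
  C.repartitions ⧸
    (C.regularRepartitions ⊔ C.principalRepartitions).comap C.repartitions.subtype

/-- The genus `g = dim_k H¹(X, 𝒪_X)`. -/
def genus : ℕ := Module.finrank k C.H1

/-! ### The jacobian and torsion points -/

/-- The group of divisors on `X`. -/
abbrev Divisor : Type _ := C.Point →₀ ℤ

/-- The degree of a divisor, each point being counted with degree one. (This is the degree when
`k` is algebraically closed, since then all residue fields are equal to `k`.) -/
def degree : C.Divisor →+ ℤ := Finsupp.liftAddHom fun _ => AddMonoidHom.id ℤ

/-- The subgroup of principal divisors `div f = ∑_P v_P(f) [P]`, with `f ∈ k(X)ˣ`. -/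
def principalDivisors : AddSubgroup C.Divisor where
  carrier := {D | ∃ f : C.FunctionField, f ≠ 0 ∧ ∀ P, D P = C.ordAt P f}
  add_mem' := by
    rintro D E ⟨f, hf, hD⟩ ⟨h, hh, hE⟩
    exact ⟨f * h, mul_ne_zero hf hh, fun P => by
      rw [Finsupp.add_apply, hD, hE, ordAt, ordAt, ordAt, Scheme.ord_mul hf hh]⟩
  zero_mem' := ⟨1, one_ne_zero, fun P => by
    have := Scheme.ord_mul (x := P.1) (one_ne_zero (α := C.FunctionField)) one_ne_zero
    rw [mul_one] at this
    simp only [Finsupp.coe_zero, Pi.zero_apply, ordAt]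
    lia⟩
  neg_mem' := by
    rintro D ⟨f, hf, hD⟩
    refine ⟨f⁻¹, inv_ne_zero hf, fun P => ?_⟩
    have h1 := Scheme.ord_mul (x := P.1) (one_ne_zero (α := C.FunctionField)) one_ne_zero
    have h2 := Scheme.ord_mul (x := P.1) hf (inv_ne_zero hf)
    rw [mul_one] at h1
    rw [mul_inv_cancel₀ hf] at h2
    rw [Finsupp.neg_apply, hD, ordAt, ordAt]
    lia

/-- The group `J(k)` of `k`-points of the jacobian variety of `X` (for `k` algebraically closed),
that is `Pic⁰(X)`: divisors of degree zero modulo principal divisors. -/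
abbrev Jacobian : Type _ := C.degree.ker ⧸ C.principalDivisors.addSubgroupOf C.degree.ker

/-- The embedding of `X` in its jacobian with base point `O`: it sends `P` to the class of
`[P] - [O]`. -/
def abelJacobi (O P : C.Point) : C.Jacobian :=
  QuotientAddGroup.mk ⟨Finsupp.single P 1 - Finsupp.single O 1, by
    rw [AddMonoidHom.mem_ker, map_sub, degree, Finsupp.liftAddHom_apply_single,
      Finsupp.liftAddHom_apply_single, sub_self]⟩

/-- `X[N] = J[N] ∩ X`: the points of `X` whose image in `J`, for the base point `O`, is killed
by `N`. -/
def torsionPoints (O : C.Point) (N : ℕ) : Set C.Point :=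
  {P | N • C.abelJacobi O P = 0}

/-! ### Pole orders at the base point -/

/-- The set of orders of poles at `O` of the nonzero functions in `𝒪_X(X - {O})`. -/
def poleOrders (O : C.Point) : Set ℕ :=
  {n | ∃ f : C.FunctionField, f ≠ 0 ∧ (∀ P, P ≠ O → C.IsRegularAt P f) ∧ C.ordAt O f = -n}

/-- The strictly increasing sequence `δ₁ = 0 < δ₂ < ⋯` of orders of poles at `O` of functions in
`𝒪_X(X - {O})`; it is numbered from one. -/
def poleOrder (O : C.Point) (n : ℕ) : ℕ := Nat.nth (· ∈ C.poleOrders O) (n - 1)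

/-! ### Ramification of the morphism to the projective line -/

open Classical in
/-- The value at `P` of the morphism `π : X → ℙ¹` defined by `x`, where the `k`-points of `ℙ¹` are
`k ∪ {∞}`: it is `x(P)` if `x` is regular at `P`, and `∞` if `x` has a pole at `P`. -/
def toP1 (x : C.FunctionField) (P : C.Point) : OnePoint k :=
  if h : ∃ c, C.HasValueAt P x c then (h.choose : OnePoint k) else OnePoint.infty

/-- The pullback to `X` of the standard uniformizer of `ℙ¹` at a point: `x - c` at the
finite point `c`, and `x⁻¹` at `∞`. -/
def pullbackUniformizer (x : C.FunctionField) : OnePoint k → C.FunctionField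
  | some c => x - algebraMap k C.FunctionField c
  | none => x⁻¹

/-- The ramification index `e_P` at `P` of the morphism `π : X → ℙ¹` defined by `x`: the valuation
at `P` of the pullback of a uniformizer of `ℙ¹` at `π(P)`. -/
def ramificationIndex (x : C.FunctionField) (P : C.Point) : ℤ :=
  C.ordAt P (C.pullbackUniformizer x (C.toP1 x P))

/-- The set of points where the morphism `X → ℙ¹` defined by `x` is ramified (over an
algebraically closed field this is a condition on the ramification index only). -/
def ramificationPoints (x : C.FunctionField) : Set C.Point :=
  {P | 2 ≤ C.ramificationIndex x P}

end

end SmoothProperCurve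

/-! ### Local rings at closed points. -/

open AlgebraicGeometry CategoryTheory TensorProduct

/-! Let `B` be the ring of functions regular away from `O`. If `P ≠ O` and `d[P] - d[O]` is the
divisor of `f`, then `f` lies in `B` and has the least positive pole order `d`, so `f = a x + b`
(`exists_eq_smul_add`) and `x` takes its value at `P` with multiplicity `d`. Conversely, if `x - c`
vanishes to order `d` at `P`, it has no other zero (`ordAt_sub_eq_zero_of_ne`), so its divisor is
`d[P] - d[O]`. This identifies `X[d]` with the points of total ramification.

The count uses the discriminant of `B` over `k[x]` instead of Riemann–Hurwitz, so wild ramification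
needs no separate treatment. Choosing in each residue class modulo `d` a function of least pole
order `w i` gives a `k[x]`-basis of `B` (`exists_basis`). There are at most `g` gaps
(`card_gaps_le`), which bounds the sum of the `w i` and shows that the discriminant has degree at
most `2g + d - 1` (`sum_apery_le`, `mul_natDegree_discr_le`). Each totally ramified `P ≠ O`
contributes a factor `(X - x(P))^(d-1)` (`pow_dvd_discr`), and these factors are coprime. The
discriminant is nonzero (`discr_ne_zero`): otherwise `x` would be a `p`-th power, against the
minimality of `d`. Adding the point `O` gives the bound.

Geometry enters through the finiteness of `H¹` by way of strong approximation
(`principalMod_eq_top`). It shows that everywhere regular functions are constant, that `d ≥ 2`, and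
that functions with prescribed behaviour away from `O` exist. -/

/-- A Noetherian local domain which is formally smooth over a field, with trivial residue field
extension and with differentials free of rank one, is a discrete valuation ring. -/
theorem isDiscreteValuationRing_of_formallySmooth (k R : Type*) [Field k] [CommRing R] [IsDomain R]
    [IsLocalRing R] [IsNoetherianRing R] [Algebra k R] [Algebra.FormallySmooth k R]
    (hres : Function.Surjective (algebraMap k (IsLocalRing.ResidueField R)))
    [Module.Free R (Ω[R⁄k])] (hrank : Module.finrank R (Ω[R⁄k]) = 1) :
    IsDiscreteValuationRing R := by
  rw [← IsLocalRing.finrank_CotangentSpace_eq_one_iff]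
  set κ := IsLocalRing.ResidueField R
  have e : k ≃ₐ[k] κ := AlgEquiv.ofBijective (Algebra.ofId k κ)
    ⟨(algebraMap k κ).injective, hres⟩
  have hκ : Algebra.FormallySmooth k κ := .of_equiv e
  have : Subsingleton (Ω[κ⁄k]) := by
    have : Algebra.FormallyUnramified k κ := .of_equiv e
    infer_instance
  have hsurj : Function.Surjective (algebraMap R κ) := IsLocalRing.residue_surjective
  -- Since `R` and `κ` are both formally smooth over `k`, the conormal map from `m/m²` to `κ ⊗
  -- Ω[R⁄k]` is split injective. Its cokernel `Ω[κ⁄k]` vanishes because `κ = k`.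
  obtain ⟨l, hl⟩ := (Algebra.FormallySmooth.iff_split_injection hsurj).mp hκ
  have hinj : Function.Injective (KaehlerDifferential.kerCotangentToTensor k R κ) :=
    Function.LeftInverse.injective (g := l) fun z => DFunLike.congr_fun hl z
  have hs : Function.Surjective (KaehlerDifferential.kerCotangentToTensor k R κ) := by
    intro z
    exact (KaehlerDifferential.exact_kerCotangentToTensor_mapBaseChange k R κ hsurj z).mp
      (Subsingleton.elim _ _)
  have h1 : Module.finrank κ (κ ⊗[R] Ω[R⁄k]) = 1 := by
    rw [Module.finrank_baseChange, hrank]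
  have hker : RingHom.ker (algebraMap R κ) = IsLocalRing.maximalIdeal R := IsLocalRing.ker_residue
  let e1 : (RingHom.ker (algebraMap R κ)).Cotangent ≃ₗ[R] κ ⊗[R] Ω[R⁄k] :=
    LinearEquiv.ofBijective _ ⟨hinj, hs⟩
  have e2 : IsLocalRing.CotangentSpace R ≃ₗ[R] κ ⊗[R] Ω[R⁄k] := by
    rw [hker] at e1
    exact e1
  have e3 : IsLocalRing.CotangentSpace R ≃ₗ[κ] κ ⊗[R] Ω[R⁄k] :=
    e2.extendScalarsOfSurjective hsurj
  rw [e3.finrank_eq, h1]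

namespace SmoothProperCurve

noncomputable section

variable {k : Type*} [Field k] (C : SmoothProperCurve k)

/-- The constants as germs at a closed point. -/
def constGerm (P : C.Point) : k →+* C.X.presheaf.stalk P.1 :=
  (C.X.presheaf.germ ⊤ P.1 trivial).hom.comp
    (C.str.appTop.hom.comp (Scheme.ΓSpecIso (.of k)).inv.hom)

lemma algebraMap_constGerm (P : C.Point) (c : k) :
    algebraMap (C.X.presheaf.stalk P.1) C.FunctionField (C.constGerm P c) =
      algebraMap k C.FunctionField c :=
  Scheme.algebraMap_germ_eq_germToFunctionField C.X _ _

/-- The isomorphism `residueFieldIsoBase` is the Nullstellensatz at a closed point; the work lies in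
checking that its inverse is the map given by the constants. -/
lemma residue_constGerm_surjective [IsAlgClosed k] (P : C.Point) :
    Function.Surjective ((C.X.residue P.1).hom.comp (C.constGerm P)) := by
  have hP : IsClosed {P.1} := P.2
  have key : (residueFieldIsoBase C.str P.1 hP).inv =
      (Scheme.ΓSpecIso (.of k)).inv ≫ C.str.appTop ≫ C.X.presheaf.germ ⊤ P.1 trivial ≫
        C.X.residue P.1 := by
    apply Spec.map_injective
    rw [SpecMap_residueFieldIsoBase_inv]
    refine ext_of_isAffine ?_
    rw [← cancel_epi (Scheme.ΓSpecIso (.of k)).inv, ← Scheme.ΓSpecIso_inv_naturality,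
      Scheme.fromSpecResidueField, Scheme.Hom.comp_appTop, Scheme.Hom.comp_appTop,
      Scheme.fromSpecStalk_appTop]
    have h (Y : Scheme) (i : (⊤ : Y.Opens) ≤ ⊤) : Y.presheaf.map (homOfLE i).op = 𝟙 _ :=
      Y.presheaf.map_id _
    simp only [Category.assoc]
    rw [h, Category.id_comp, Scheme.ΓSpecIso_inv_naturality, Scheme.ΓSpecIso_inv_naturality_assoc]
  have : Function.Surjective (residueFieldIsoBase C.str P.1 hP).inv.hom :=
    (ConcreteCategory.bijective_of_isIso (residueFieldIsoBase C.str P.1 hP).inv).2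
  rw [key] at this
  exact this

/-- A standard smooth neighbourhood of relative dimension one has differentials free of rank one.
The stalk is a localization of it, hence formally étale over it, so its differentials are the base
change. -/
instance isDiscreteValuationRing_stalk [IsAlgClosed k] (P : C.Point) :
    IsDiscreteValuationRing (C.X.presheaf.stalk P.1) := by
  obtain ⟨U, hU, V, hV, hPV, e, hf⟩ :=
    SmoothOfRelativeDimension.exists_isStandardSmoothOfRelativeDimension (n := 1) (f := C.str) P.1
  have hUtop : U = ⊤ := by
    ext y
    have : y = C.str P.1 := Subsingleton.elim _ _
    simpa [this] using e hPV
  subst hUtop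
  let φ : k →+* Γ(C.X, V) :=
    (C.str.appLE ⊤ V e).hom.comp (Scheme.ΓSpecIso (.of k)).inv.hom
  algebraize [φ, (C.X.presheaf.germ V P.1 hPV).hom, C.constGerm P]
  have : IsScalarTower k Γ(C.X, V) (C.X.presheaf.stalk P.1) := by
    refine .of_algebraMap_eq' ?_
    ext c
    simp only [RingHom.algebraMap_toAlgebra, φ, constGerm, Scheme.Hom.appLE, RingHom.comp_apply]
    exact (C.X.presheaf.germ_res_apply (homOfLE e) P.1 hPV _).symm
  have hstd : Algebra.IsStandardSmoothOfRelativeDimension 1 k Γ(C.X, V) := by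
    let e : k ≃+* Γ(Spec (.of k), ⊤) := (Scheme.ΓSpecIso (.of k)).symm.commRingCatIsoToRingEquiv
    have h1 := RingHom.IsStandardSmoothOfRelativeDimension.equiv e
    exact hf.comp h1
  have : Algebra.IsStandardSmooth k Γ(C.X, V) := hstd.isStandardSmooth
  have : IsLocalization.AtPrime (C.X.presheaf.stalk P.1) (hV.primeIdealOf ⟨P.1, hPV⟩).asIdeal :=
    hV.isLocalization_stalk ⟨P.1, hPV⟩
  have : Algebra.FormallyEtale Γ(C.X, V) (C.X.presheaf.stalk P.1) :=
    .of_isLocalization (hV.primeIdealOf ⟨P.1, hPV⟩).asIdeal.primeCompl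
  have : Algebra.FormallySmooth k (C.X.presheaf.stalk P.1) :=
    .comp k Γ(C.X, V) (C.X.presheaf.stalk P.1)
  have : Nontrivial Γ(C.X, V) :=
    (algebraMap Γ(C.X, V) (C.X.presheaf.stalk P.1)).domain_nontrivial
  let e1 := KaehlerDifferential.tensorKaehlerEquivOfFormallyEtale k Γ(C.X, V)
    (C.X.presheaf.stalk P.1)
  have : Module.Free (C.X.presheaf.stalk P.1) (Ω[C.X.presheaf.stalk P.1⁄k]) := .of_equiv e1
  refine isDiscreteValuationRing_of_formallySmooth k _ (C.residue_constGerm_surjective P) ?_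
  rw [← e1.finrank_eq, Module.finrank_baseChange]
  exact Module.finrank_eq_of_rank_eq
    (Algebra.IsStandardSmoothOfRelativeDimension.rank_kaehlerDifferential 1)

/-! ### The valuation at a closed point -/

variable {C} {P : C.Point} {f h : C.FunctionField}

lemma ordAt_zero (P : C.Point) : C.ordAt P 0 = 0 := by
  simp [ordAt]

lemma ordAt_mul (hf : f ≠ 0) (hh : h ≠ 0) : C.ordAt P (f * h) = C.ordAt P f + C.ordAt P h :=
  Scheme.ord_mul hf hh

variable [IsAlgClosed k]

lemma coheight_eq_one (P : C.Point) : Order.coheight P.1 = 1 := by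
  have h1 := ringKrullDim_stalk_eq_coheight P.1
  rw [IsDiscreteValuationRing.ringKrullDim_eq_one] at h1
  exact_mod_cast h1.symm

lemma min_le_ordAt_add (hfh : f + h ≠ 0) :
    min (C.ordAt P f) (C.ordAt P h) ≤ C.ordAt P (f + h) :=
  Scheme.ord_add hfh

lemma ordAt_algebraMap_eq_zero_iff {a : C.X.presheaf.stalk P.1} (ha : a ≠ 0) :
    C.ordAt P (algebraMap _ C.FunctionField a) = 0 ↔ IsUnit a := by
  have ha' : algebraMap _ C.FunctionField a ≠ 0 := by simpa using ha
  rw [ordAt, Scheme.ord_eq_iff (coheight_eq_one P) ha',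
    Ring.isUnit_iff_ordFrac_one_of_isDiscreteValuationRing (K := C.FunctionField)]
  rfl

lemma ordAt_algebraMap_nonneg (a : C.X.presheaf.stalk P.1) :
    0 ≤ C.ordAt P (algebraMap _ C.FunctionField a) := by
  by_cases ha : a = 0
  · simp [ha, ordAt_zero]
  have ha' : algebraMap _ C.FunctionField a ≠ 0 := by simpa using ha
  rw [ordAt, Scheme.le_ord_iff (coheight_eq_one P) ha']
  have := krullDimLE_of_coheight_le (coheight_eq_one P).le
  exact Ring.ordFrac_ge_one_of_ne_zero ha

lemma ordAt_one (P : C.Point) : C.ordAt P 1 = 0 := by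
  rw [← map_one (algebraMap (C.X.presheaf.stalk P.1) C.FunctionField),
    ordAt_algebraMap_eq_zero_iff one_ne_zero]
  exact isUnit_one

lemma ordAt_inv (f : C.FunctionField) (P : C.Point) : C.ordAt P f⁻¹ = -C.ordAt P f := by
  by_cases hf : f = 0
  · simp [hf, ordAt_zero]
  have := ordAt_mul (P := P) hf (inv_ne_zero hf)
  rw [mul_inv_cancel₀ hf, ordAt_one] at this
  lia

lemma ordAt_pow (f : C.FunctionField) (P : C.Point) (n : ℕ) :
    C.ordAt P (f ^ n) = n * C.ordAt P f := by
  by_cases hf : f = 0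
  · cases n <;> simp [hf, ordAt_zero, ordAt_one]
  induction n with
  | zero => simp [ordAt_one]
  | succ n ih => rw [pow_succ, ordAt_mul (pow_ne_zero _ hf) hf, ih]; push_cast; ring

lemma isRegularAt_iff : C.IsRegularAt P f ↔ 0 ≤ C.ordAt P f := by
  constructor
  · rintro ⟨a, rfl⟩
    exact ordAt_algebraMap_nonneg a
  intro hf
  -- If only `f⁻¹` is known to be integral, its valuation is both nonnegative and nonpositive, so it
  -- is a unit.
  rcases ValuationRing.isInteger_or_isInteger (C.X.presheaf.stalk P.1) f with ⟨a, ha⟩ | ⟨a, ha⟩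
  · exact ⟨a, ha⟩
  by_cases h0 : a = 0
  · rw [h0, map_zero, eq_comm, inv_eq_zero] at ha
    exact ⟨0, by simp [ha]⟩
  have h1 : C.ordAt P (algebraMap _ C.FunctionField a) = 0 := by
    have := ordAt_algebraMap_nonneg (C := C) a
    rw [ha, ordAt_inv] at this ⊢
    lia
  obtain ⟨u, rfl⟩ := (ordAt_algebraMap_eq_zero_iff h0).mp h1
  refine ⟨(u⁻¹ : (C.X.presheaf.stalk P.1)ˣ), ?_⟩
  rw [← inv_inv f, ← ha]
  exact map_units_inv _ u

lemma exists_ordAt_eq_one (P : C.Point) : ∃ t : C.FunctionField, C.ordAt P t = 1 := by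
  obtain ⟨ϖ, hϖ⟩ := IsDiscreteValuationRing.exists_irreducible (C.X.presheaf.stalk P.1)
  refine ⟨algebraMap _ _ ϖ, ?_⟩
  rw [ordAt, Scheme.ord_eq_iff (coheight_eq_one P) (by simpa using hϖ.ne_zero)]
  exact Ring.ordFrac_irreducible hϖ

variable (C) in
/-- The functions of valuation at least `n` at `P`. -/
def ordGE (P : C.Point) (n : ℤ) : Submodule k C.FunctionField where
  -- The guard `f ≠ 0` makes zero a member for every `n`, although `ordAt` assigns it the value `0`.
  carrier := {f | f ≠ 0 → n ≤ C.ordAt P f}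
  add_mem' {f h} hf hh hfh := by
    by_cases hf0 : f = 0
    · subst hf0; rw [zero_add] at hfh ⊢; exact hh hfh
    by_cases hh0 : h = 0
    · subst hh0; rw [add_zero] at hfh ⊢; exact hf hfh
    exact (le_min (hf hf0) (hh hh0)).trans (min_le_ordAt_add hfh)
  zero_mem' h := (h rfl).elim
  smul_mem' c f hf hcf := by
    rw [Algebra.smul_def] at hcf ⊢
    rw [ordAt_mul (left_ne_zero_of_mul hcf) (right_ne_zero_of_mul hcf)]
    have := isRegularAt_iff.mp (C.isRegularAt_algebraMap P c)
    have := hf (right_ne_zero_of_mul hcf)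
    lia

lemma mem_ordGE {n : ℤ} : f ∈ C.ordGE P n ↔ (f ≠ 0 → n ≤ C.ordAt P f) := Iff.rfl

lemma isRegularAt_iff_mem : C.IsRegularAt P f ↔ f ∈ C.ordGE P 0 := by
  rw [isRegularAt_iff, mem_ordGE]
  refine ⟨fun h _ => h, fun h => ?_⟩
  by_cases hf : f = 0
  · simp [hf, ordAt_zero]
  · exact h hf

lemma ordGE_anti {m n : ℤ} (h : m ≤ n) : C.ordGE P n ≤ C.ordGE P m :=
  fun _ hf h0 => h.trans (hf h0)

lemma mul_mem_ordGE {m n : ℤ} (hf : f ∈ C.ordGE P m) (hh : h ∈ C.ordGE P n) :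
    f * h ∈ C.ordGE P (m + n) := fun h0 => by
  rw [ordAt_mul (left_ne_zero_of_mul h0) (right_ne_zero_of_mul h0)]
  exact add_le_add (hf (left_ne_zero_of_mul h0)) (hh (right_ne_zero_of_mul h0))

lemma mem_ordGE_ordAt (f : C.FunctionField) (P : C.Point) : f ∈ C.ordGE P (C.ordAt P f) :=
  fun _ => le_rfl

lemma pow_mem_ordGE {m : ℤ} (hf : f ∈ C.ordGE P m) (n : ℕ) : f ^ n ∈ C.ordGE P (n * m) := by
  intro h0
  rw [ordAt_pow]
  by_cases hn : n = 0
  · simp [hn]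
  · exact mul_le_mul_of_nonneg_left (hf fun h => h0 (by simp [h, hn])) (by positivity)

lemma algebraMap_mem_ordGE (c : k) (P : C.Point) : algebraMap k C.FunctionField c ∈ C.ordGE P 0 :=
  isRegularAt_iff_mem.mp (C.isRegularAt_algebraMap P c)

lemma ordAt_algebraMap (c : k) (P : C.Point) : C.ordAt P (algebraMap k C.FunctionField c) = 0 := by
  have h1 := isRegularAt_iff.mp (C.isRegularAt_algebraMap P c)
  have h2 := isRegularAt_iff.mp (C.isRegularAt_algebraMap P c⁻¹)
  rw [map_inv₀, ordAt_inv] at h2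
  lia

lemma ordAt_neg (f : C.FunctionField) (P : C.Point) : C.ordAt P (-f) = C.ordAt P f := by
  by_cases hf : f = 0
  · simp [hf]
  have : -f = algebraMap k C.FunctionField (-1) * f := by simp
  rw [this, ordAt_mul (by simp) hf, ordAt_algebraMap, zero_add]

lemma hasValueAt_iff {c : k} :
    C.HasValueAt P f c ↔ f - algebraMap k C.FunctionField c ∈ C.ordGE P 1 := by
  constructor
  · rintro ⟨a, ha, h⟩
    rw [← h]
    intro h0
    have ha0 : a ≠ 0 := by rintro rfl; simp at h0
    have h1 := ordAt_algebraMap_nonneg (C := C) a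
    have h2 := (ordAt_algebraMap_eq_zero_iff (C := C) ha0).not.mpr ha
    lia
  · intro h
    obtain ⟨a, ha⟩ := isRegularAt_iff_mem.mpr (ordGE_anti zero_le_one h)
    refine ⟨a, fun hu => ?_, ha⟩
    have h1 := h (by rw [← ha]; simpa using hu.ne_zero)
    rw [← ha, (ordAt_algebraMap_eq_zero_iff hu.ne_zero).mpr hu] at h1
    lia

lemma exists_sub_mem_ordGE_one (hf : f ∈ C.ordGE P 0) :
    ∃ c : k, f - algebraMap k C.FunctionField c ∈ C.ordGE P 1 := by
  obtain ⟨a, rfl⟩ := isRegularAt_iff_mem.mpr hf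
  obtain ⟨c, hc⟩ := C.residue_constGerm_surjective P (C.X.residue P.1 a)
  refine ⟨c, hasValueAt_iff.mp ⟨a - C.constGerm P c, ?_, by rw [map_sub, algebraMap_constGerm]⟩⟩
  rw [← IsLocalRing.residue_eq_zero_iff, map_sub, sub_eq_zero]
  exact hc.symm

/-- Subtracting a multiple of `h` from `f` to increase the valuation. -/
lemma exists_sub_smul_mem_ordGE {n : ℤ} (hf : f ∈ C.ordGE P n) (h0 : h ≠ 0)
    (hn : C.ordAt P h = n) : ∃ c : k, f - c • h ∈ C.ordGE P (n + 1) := by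
  have h1 : f * h⁻¹ ∈ C.ordGE P 0 := by
    have := mul_mem_ordGE hf (mem_ordGE_ordAt h⁻¹ P)
    rwa [ordAt_inv, hn, add_neg_cancel] at this
  obtain ⟨c, hc⟩ := exists_sub_mem_ordGE_one h1
  refine ⟨c, ?_⟩
  have := mul_mem_ordGE hc (mem_ordGE_ordAt h P)
  rw [hn, add_comm] at this
  convert this using 1
  rw [Algebra.smul_def]
  field_simp

end

end SmoothProperCurve

open AlgebraicGeometry CategoryTheory

namespace SmoothProperCurve

noncomputable section

variable {k : Type*} [Field k] {C : SmoothProperCurve k}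

/-! ### Strong approximation -/

lemma coe_mem_repartitions (a : C.Point →₀ C.FunctionField) : ⇑a ∈ C.repartitions :=
  a.support.finite_toSet.subset fun P (hP : a P ∉ C.localRing P) => by
    rw [Finset.mem_coe, Finsupp.mem_support_iff]
    intro h
    exact hP (h ▸ Submodule.zero_mem _)

variable (C) in
/-- The class in `H¹` of a finitely supported family. -/
def finsuppToH1 : (C.Point →₀ C.FunctionField) →ₗ[k] C.H1 :=
  (Submodule.mkQ _).comp
    (LinearMap.codRestrict C.repartitions Finsupp.lcoeFun coe_mem_repartitions)

-- `finrank` is `0` on infinite-dimensional spaces, so positive genus already contains the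
-- finiteness of `H¹`.
variable (C) in
lemma finite_H1 (hg : 1 ≤ C.genus) : Module.Finite k C.H1 :=
  Module.finite_of_finrank_pos hg

lemma finsuppToH1_surjective : Function.Surjective C.finsuppToH1 := by
  classical
  intro q
  obtain ⟨⟨a, ha⟩, rfl⟩ := Submodule.mkQ_surjective _ q
  refine ⟨Finsupp.onFinset (Set.Finite.toFinset ha) (fun P => if a P ∈ C.localRing P then 0 else a P)
    fun P hP => ?_, ?_⟩
  · simp only [ne_eq, ite_eq_left_iff, not_forall] at hP
    exact (Set.Finite.mem_toFinset ha).mpr hP.1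
  · simp only [finsuppToH1, LinearMap.comp_apply]
    rw [← sub_eq_zero, ← map_sub, Submodule.mkQ_apply, Submodule.Quotient.mk_eq_zero]
    refine Submodule.mem_sup_left (S := C.regularRepartitions) fun P => ?_
    change (if a P ∈ C.localRing P then 0 else a P) - a P ∈ _
    split_ifs with h
    · rw [zero_sub]; exact Submodule.neg_mem _ h
    · simp

variable [IsAlgClosed k]

lemma mem_localRing_iff {P : C.Point} {f : C.FunctionField} :
    f ∈ C.localRing P ↔ f ∈ C.ordGE P 0 :=
  isRegularAt_iff_mem

variable (C) in
/-- The finitely supported families which, up to a global function, are regular outside `S`. -/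
def principalMod (S : Set C.Point) : Submodule k (C.Point →₀ C.FunctionField) where
  carrier := {a | ∃ f : C.FunctionField, ∀ P ∉ S, f - a P ∈ C.ordGE P 0}
  add_mem' := by
    rintro a b ⟨f, hf⟩ ⟨h, hh⟩
    refine ⟨f + h, fun P hP => ?_⟩
    rw [Finsupp.add_apply, add_sub_add_comm]
    exact Submodule.add_mem _ (hf P hP) (hh P hP)
  zero_mem' := ⟨0, fun P _ => by simp⟩
  smul_mem' := by
    rintro c a ⟨f, hf⟩
    refine ⟨c • f, fun P hP => ?_⟩
    rw [Finsupp.smul_apply, ← smul_sub]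
    exact Submodule.smul_mem _ _ (hf P hP)

lemma finsuppToH1_eq_zero_iff {a : C.Point →₀ C.FunctionField} :
    C.finsuppToH1 a = 0 ↔ ∃ f : C.FunctionField, ∀ P, f - a P ∈ C.ordGE P 0 := by
  simp only [finsuppToH1, LinearMap.comp_apply, Submodule.mkQ_apply, Submodule.Quotient.mk_eq_zero,
    Submodule.mem_comap, Submodule.mem_sup]
  constructor
  · rintro ⟨r, hr, _, ⟨f, rfl⟩, h⟩
    refine ⟨f, fun P => ?_⟩
    have hP : r P + f = a P := congrFun h P
    have : f - a P = -r P := by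
      rw [← hP]
      ring
    rw [this]
    exact Submodule.neg_mem _ (mem_localRing_iff.mp (hr P))
  · rintro ⟨f, hf⟩
    refine ⟨fun P => a P - f, fun P => mem_localRing_iff.mpr ?_, _, ⟨f, rfl⟩, ?_⟩
    · rw [← neg_mem_iff, neg_sub]
      exact hf P
    · ext P
      exact sub_add_cancel (a P) f

/-- If `H¹` is finite-dimensional and some nonconstant function is regular outside `S`, then every
finitely supported family is approximated outside `S` by a global function. -/
theorem principalMod_eq_top [Module.Finite k C.H1] {S : Set C.Point} {u : C.FunctionField}
    (hu : u ∉ (algebraMap k C.FunctionField).range) (hreg : ∀ P ∉ S, u ∈ C.ordGE P 0) :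
    C.principalMod S = ⊤ := by
  -- Multiplication by `u` acts on the quotient by `N`, which is finite-dimensional, being a
  -- quotient of `H¹`. If it were nonzero, `u` would have an eigenvalue `c`. But `u - c` is a
  -- nonzero function, and dividing families by it shows that `u - c` acts surjectively, hence
  -- injectively.
  set N := C.principalMod S
  let T : (C.Point →₀ C.FunctionField) →ₗ[k] (C.Point →₀ C.FunctionField) :=
    Finsupp.mapRange.linearMap (LinearMap.mulLeft k u)
  have hT (a) (P) : T a P = u * a P := by simp [T]
  have hTN : N ≤ N.comap T := by
    rintro a ⟨f, hf⟩
    refine ⟨u * f, fun P hP => ?_⟩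
    rw [hT, ← mul_sub, ← zero_add (0 : ℤ)]
    exact mul_mem_ordGE (hreg P hP) (hf P hP)
  have hker : LinearMap.ker C.finsuppToH1 ≤ N := fun a ha => by
    obtain ⟨f, hf⟩ := finsuppToH1_eq_zero_iff.mp (LinearMap.mem_ker.mp ha)
    exact ⟨f, fun P _ => hf P⟩
  have : Module.Finite k ((C.Point →₀ C.FunctionField) ⧸ LinearMap.ker C.finsuppToH1) :=
    Module.Finite.of_injective _ (LinearMap.ker_eq_bot.mp (Submodule.ker_liftQ_eq_bot _
      C.finsuppToH1 le_rfl le_rfl))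
  have : Module.Finite k ((C.Point →₀ C.FunctionField) ⧸ N) :=
    Module.Finite.of_surjective _ (Submodule.factor_surjective hker)
  by_contra hN
  have : Nontrivial ((C.Point →₀ C.FunctionField) ⧸ N) := Submodule.Quotient.nontrivial_iff.mpr hN
  obtain ⟨c, hc⟩ := Module.End.exists_eigenvalue (N.mapQ N T hTN)
  have hne : u - algebraMap k C.FunctionField c ≠ 0 := fun h => hu ⟨c, (sub_eq_zero.mp h).symm⟩
  refine hc ?_
  change Module.End.eigenspace _ c = ⊥
  rw [Module.End.eigenspace_def, LinearMap.ker_eq_bot, LinearMap.injective_iff_surjective]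
  intro q
  obtain ⟨a, rfl⟩ := N.mkQ_surjective q
  refine ⟨N.mkQ (Finsupp.mapRange.linearMap
    (LinearMap.mulLeft k (u - algebraMap k C.FunctionField c)⁻¹) a), ?_⟩
  simp only [LinearMap.sub_apply, Submodule.mkQ_apply, Submodule.mapQ_apply,
    LinearMap.smul_apply, Module.End.one_apply]
  rw [← Submodule.Quotient.mk_smul, ← Submodule.Quotient.mk_sub]
  congr 1
  ext P
  simp only [Finsupp.sub_apply, hT, Finsupp.smul_apply, Finsupp.mapRange.linearMap_apply,
    Finsupp.mapRange_apply, LinearMap.mulLeft_apply, Algebra.smul_def]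
  field_simp

/-- A function on a curve of positive genus which is regular everywhere is constant. -/
theorem mem_range_algebraMap_of_regular (hg : 1 ≤ C.genus) {u : C.FunctionField}
    (hu : ∀ P, u ∈ C.ordGE P 0) : u ∈ (algebraMap k C.FunctionField).range := by
  by_contra h
  have := C.finite_H1 hg
  -- For empty `S` the approximation statement says that `H¹` vanishes.
  have htop := principalMod_eq_top (S := ∅) h fun P _ => hu P
  have : Subsingleton C.H1 := ⟨by
    suffices ∀ q : C.H1, q = 0 by intro a b; rw [this a, this b]
    intro q
    obtain ⟨a, rfl⟩ := finsuppToH1_surjective q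
    rw [finsuppToH1_eq_zero_iff]
    obtain ⟨f, hf⟩ : a ∈ C.principalMod ∅ := htop ▸ Submodule.mem_top
    exact ⟨f, fun P => hf P (Set.notMem_empty P)⟩⟩
  have h0 : C.genus = 0 := Module.finrank_zero_of_subsingleton
  lia

/-- A curve with a function with a single pole, which is simple, has genus zero. -/
theorem ordAt_ne_neg_one (hg : 1 ≤ C.genus) {O : C.Point} {u : C.FunctionField}
    (hu : ∀ P ≠ O, u ∈ C.ordGE P 0) : C.ordAt O u ≠ -1 := by
  intro hO
  have := C.finite_H1 hg
  have hconst : u ∉ (algebraMap k C.FunctionField).range := by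
    rintro ⟨c, rfl⟩
    rw [ordAt_algebraMap] at hO
    lia
  have hu0 : u ≠ 0 := by rintro rfl; rw [ordAt_zero] at hO; lia
  have htop := principalMod_eq_top (S := {O}) hconst fun P hP => hu P hP
  -- A polynomial in `u` can cancel any principal part at `O`, since `u ^ n` has a pole of order
  -- exactly `n` there. So the approximation extends across `O`, and `H¹` vanishes.
  have hpole (n : ℕ) : ∀ h : C.FunctionField, h ∈ C.ordGE O (-n) →
      ∃ p : C.FunctionField, (∀ P ≠ O, p ∈ C.ordGE P 0) ∧ h - p ∈ C.ordGE O 0 := by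
    induction n with
    | zero => exact fun h hh => ⟨0, fun P _ => by simp, by simpa using hh⟩
    | succ n ih =>
      intro h hh
      obtain ⟨c, hc⟩ := exists_sub_smul_mem_ordGE (h := u ^ (n + 1)) hh (pow_ne_zero _ hu0)
        (by rw [ordAt_pow, hO]; ring)
      obtain ⟨p, hp, hp'⟩ := ih _ (by convert hc using 2; push_cast; ring)
      refine ⟨p + c • u ^ (n + 1), fun P hP => Submodule.add_mem _ (hp P hP)
        (Submodule.smul_mem _ _ ?_), by rwa [add_comm, ← sub_sub]⟩
      simpa using pow_mem_ordGE (hu P hP) (n + 1)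
  have : Subsingleton C.H1 := ⟨by
    suffices ∀ q : C.H1, q = 0 by intro a b; rw [this a, this b]
    intro q
    obtain ⟨a, rfl⟩ := finsuppToH1_surjective q
    rw [finsuppToH1_eq_zero_iff]
    obtain ⟨f, hf⟩ : a ∈ C.principalMod {O} := htop ▸ Submodule.mem_top
    obtain ⟨p, hp, hp'⟩ := hpole (C.ordAt O (f - a O)).natAbs (f - a O)
      (ordGE_anti (by lia) (mem_ordGE_ordAt _ _))
    refine ⟨f - p, fun P => ?_⟩
    rw [sub_right_comm]
    by_cases hP : P = O
    · subst hP; exact hp'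
    · exact Submodule.sub_mem _ (hf P hP) (hp P hP)⟩
  have h0 : C.genus = 0 := Module.finrank_zero_of_subsingleton
  lia

end

end SmoothProperCurve

open AlgebraicGeometry CategoryTheory Polynomial

namespace SmoothProperCurve

noncomputable section

variable {k : Type*} [Field k] {C : SmoothProperCurve k} [IsAlgClosed k]

/-! ### Pole orders -/

lemma ordAt_add_of_mem {P : C.Point} {f r : C.FunctionField} (hf : f ≠ 0)
    (hr : r ∈ C.ordGE P (C.ordAt P f + 1)) : f + r ≠ 0 ∧ C.ordAt P (f + r) = C.ordAt P f := by
  have hne : f + r ≠ 0 := by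
    intro h
    have hr' : r = -f := by linear_combination h
    have := hr (by rw [hr']; simpa)
    rw [hr', ordAt_neg] at this
    lia
  refine ⟨hne, le_antisymm ?_ ?_⟩
  · by_contra! hlt
    have h1 : f + r ∈ C.ordGE P (C.ordAt P f + 1) := fun _ => hlt
    have h2 := Submodule.sub_mem _ h1 hr
    rw [add_sub_cancel_right] at h2
    have := h2 hf
    lia
  · exact Submodule.add_mem _ (mem_ordGE_ordAt f P) (ordGE_anti (by lia) hr) hne

lemma ordAt_sum_of_mem {ι : Type*} {P : C.Point} {s : Finset ι} {g : ι → C.FunctionField} {i : ι}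
    (hi : i ∈ s) (h0 : g i ≠ 0) (hg : ∀ j ∈ s, j ≠ i → g j ∈ C.ordGE P (C.ordAt P (g i) + 1)) :
    ∑ j ∈ s, g j ≠ 0 ∧ C.ordAt P (∑ j ∈ s, g j) = C.ordAt P (g i) := by
  classical
  rw [← Finset.add_sum_erase s g hi]
  exact ordAt_add_of_mem h0 (Submodule.sum_mem _ fun j hj =>
    hg j (Finset.mem_of_mem_erase hj) (Finset.ne_of_mem_erase hj))

lemma ordAt_smul {P : C.Point} {c : k} (hc : c ≠ 0) (f : C.FunctionField) :
    C.ordAt P (c • f) = C.ordAt P f := by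
  by_cases hf : f = 0
  · simp [hf]
  rw [Algebra.smul_def, ordAt_mul (by simpa) hf, ordAt_algebraMap, zero_add]

variable (C) in
/-- The ring of functions which are regular away from `O`. -/
def regularAway (O : C.Point) : Subalgebra k C.FunctionField where
  carrier := {f | ∀ P ≠ O, f ∈ C.ordGE P 0}
  add_mem' hf hh P hP := Submodule.add_mem _ (hf P hP) (hh P hP)
  mul_mem' hf hh P hP := by simpa using mul_mem_ordGE (hf P hP) (hh P hP)
  algebraMap_mem' c P _ := algebraMap_mem_ordGE c P

variable {O : C.Point}

lemma mem_poleOrders_iff {n : ℕ} :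
    n ∈ C.poleOrders O ↔ ∃ f : C.regularAway O, f ≠ 0 ∧ C.ordAt O f = -n := by
  constructor
  · rintro ⟨f, h0, hf, hO⟩
    exact ⟨⟨f, fun P hP => isRegularAt_iff_mem.mp (hf P hP)⟩, by simpa [Subtype.ext_iff], hO⟩
  · rintro ⟨f, h0, hO⟩
    exact ⟨f, by simpa, fun P hP => isRegularAt_iff_mem.mpr (f.2 P hP), hO⟩

lemma exists_eq_algebraMap_of_ordAt_nonneg (hg : 1 ≤ C.genus) {f : C.FunctionField}
    (hf : f ∈ C.regularAway O) (h0 : 0 ≤ C.ordAt O f) : ∃ c, algebraMap k C.FunctionField c = f :=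
  mem_range_algebraMap_of_regular hg fun P => by
    by_cases hP : P = O
    · subst hP; exact fun _ => h0
    · exact hf P hP

lemma ordAt_nonpos (hg : 1 ≤ C.genus) {f : C.FunctionField} (hf : f ∈ C.regularAway O) :
    C.ordAt O f ≤ 0 := by
  by_contra! h
  obtain ⟨c, rfl⟩ := exists_eq_algebraMap_of_ordAt_nonneg hg hf h.le
  rw [ordAt_algebraMap] at h
  lia

lemma natAbs_ordAt_mem_poleOrders (hg : 1 ≤ C.genus) {f : C.FunctionField}
    (hf : f ∈ C.regularAway O) (h0 : f ≠ 0) : (C.ordAt O f).natAbs ∈ C.poleOrders O :=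
  mem_poleOrders_iff.mpr ⟨⟨f, hf⟩, by simpa [Subtype.ext_iff], by
    have := ordAt_nonpos hg hf
    simp only
    lia⟩

lemma zero_mem_poleOrders : 0 ∈ C.poleOrders O :=
  ⟨1, one_ne_zero, fun P _ => isRegularAt_iff.mpr (ordAt_one P).ge, ordAt_one O⟩

/-- There are at most `g` gaps. -/
theorem card_gaps_le (hg : 1 ≤ C.genus) (G : Finset ℕ) (hG : ∀ n ∈ G, n ∉ C.poleOrders O) :
    G.card ≤ C.genus := by
  classical
  have := C.finite_H1 hg
  obtain ⟨t, ht⟩ := exists_ordAt_eq_one O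
  have ht0 : t ≠ 0 := by rintro rfl; rw [ordAt_zero] at ht; lia
  have hord (n : ℕ) : C.ordAt O (t⁻¹ ^ n) = -n := by rw [ordAt_pow, ordAt_inv, ht]; ring
  -- A relation among these principal parts would give a function regular away from `O` with the
  -- same principal part at `O`. Its pole order would be the largest `n` in the relation, yet `n` is
  -- a gap.
  have hli : LinearIndependent k fun n : G => C.finsuppToH1 (Finsupp.single O (t⁻¹ ^ (n : ℕ))) := by
    rw [Fintype.linearIndependent_iff]
    intro c hc
    by_contra! hne
    obtain ⟨i, hi, hmax⟩ := Finset.exists_max_image (Finset.univ.filter fun i => c i ≠ 0)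
      (fun i : G => (i : ℕ)) (by simpa [Finset.Nonempty] using hne)
    simp only [Finset.mem_filter, Finset.mem_univ, true_and] at hi hmax
    set w : C.FunctionField := ∑ i, c i • t⁻¹ ^ (i : ℕ)
    have hw : C.finsuppToH1 (Finsupp.single O w) = 0 := by
      rw [← hc, Finsupp.single_finsetSum, map_sum]
      simp only [← Finsupp.smul_single, map_smul]
    obtain ⟨f, hf⟩ := finsuppToH1_eq_zero_iff.mp hw
    have hterm : C.ordAt O (c i • t⁻¹ ^ (i : ℕ)) = -(i : ℕ) := by rw [ordAt_smul hi, hord]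
    obtain ⟨hw0, hwO⟩ : w ≠ 0 ∧ C.ordAt O w = C.ordAt O (c i • t⁻¹ ^ (i : ℕ)) := by
      refine ordAt_sum_of_mem (Finset.mem_univ i) (by simp [hi, ht0]) fun j _ hj => ?_
      by_cases hcj : c j = 0
      · simp [hcj]
      · intro _
        rw [hterm, ordAt_smul hcj, hord]
        have := hmax j hcj
        have : (j : ℕ) ≠ i := fun h => hj (Subtype.ext h)
        lia
    have hipos : (i : ℕ) ≠ 0 := fun h => hG i i.2 (h ▸ zero_mem_poleOrders)
    obtain ⟨hf0, hfO⟩ := ordAt_add_of_mem (r := f - w) hw0 (by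
      rw [hwO, hterm]
      refine ordGE_anti (n := 0) (by lia) (by simpa using hf O))
    rw [add_sub_cancel] at hf0 hfO
    refine hG i i.2 (mem_poleOrders_iff.mpr ⟨⟨f, fun P hP => ?_⟩, by simpa [Subtype.ext_iff], ?_⟩)
    · simpa [Finsupp.single_apply, hP.symm] using hf P
    · rw [hfO, hwO, hterm]
  exact (Fintype.card_coe G).symm.trans_le hli.fintype_card_le_finrank

lemma finite_compl_poleOrders (hg : 1 ≤ C.genus) (O : C.Point) : (C.poleOrders O)ᶜ.Finite := by
  by_contra h
  obtain ⟨G, hG, hcard⟩ := Set.Infinite.exists_subset_card_eq h (C.genus + 1)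
  have := card_gaps_le hg G fun n hn => hG hn
  lia

lemma infinite_poleOrders (hg : 1 ≤ C.genus) (O : C.Point) : (C.poleOrders O).Infinite :=
  fun h => Set.infinite_univ (α := ℕ) (by
    simpa using h.union (finite_compl_poleOrders hg O))

lemma poleOrder_two_mem (hg : 1 ≤ C.genus) (O : C.Point) : C.poleOrder O 2 ∈ C.poleOrders O :=
  Nat.nth_mem_of_infinite (infinite_poleOrders hg O) _

lemma poleOrder_two_pos (hg : 1 ≤ C.genus) (O : C.Point) : 0 < C.poleOrder O 2 :=
  (Nat.zero_le _).trans_lt (Nat.nth_strictMono (infinite_poleOrders hg O) one_pos)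

lemma two_le_poleOrder_two (hg : 1 ≤ C.genus) (O : C.Point) : 2 ≤ C.poleOrder O 2 := by
  have h1 := poleOrder_two_pos hg O
  obtain ⟨f, -, hf⟩ := mem_poleOrders_iff.mp (poleOrder_two_mem hg O)
  by_contra! h2
  have h3 : C.poleOrder O 2 = 1 := by lia
  exact ordAt_ne_neg_one hg f.2 (by rw [hf, h3]; rfl)

lemma poleOrder_two_le (hg : 1 ≤ C.genus) {n : ℕ} (hn : n ∈ C.poleOrders O) (h0 : n ≠ 0) :
    C.poleOrder O 2 ≤ n := by
  obtain ⟨i, rfl⟩ : n ∈ Set.range (Nat.nth (· ∈ C.poleOrders O)) := by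
    rw [Nat.range_nth_of_infinite (p := (· ∈ C.poleOrders O)) (infinite_poleOrders hg O)]
    exact hn
  refine (Nat.nth_strictMono (infinite_poleOrders hg O)).monotone ?_
  by_contra! hi
  have : i = 0 := by lia
  subst this
  exact h0 (Nat.nth_zero_of_zero zero_mem_poleOrders)

/-- A function with a pole of the smallest possible order at `O` and regular elsewhere is unique
up to affine transformations. -/
theorem exists_eq_smul_add (hg : 1 ≤ C.genus) {x f : C.FunctionField} (hx : x ∈ C.regularAway O)
    (hf : f ∈ C.regularAway O) (hxO : C.ordAt O x = -(C.poleOrder O 2 : ℤ))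
    (hfO : C.ordAt O f = -(C.poleOrder O 2 : ℤ)) :
    ∃ a b : k, f = a • x + algebraMap k C.FunctionField b := by
  have hpos := poleOrder_two_pos hg O
  -- Cancelling the leading terms leaves a pole of order less than the minimum, hence no pole, hence
  -- a constant.
  obtain ⟨a, ha⟩ := exists_sub_smul_mem_ordGE (mem_ordGE_ordAt f O) (h := x)
    (by rintro rfl; rw [ordAt_zero] at hxO; lia) (hxO.trans hfO.symm)
  have hB : f - a • x ∈ C.regularAway O := sub_mem hf (Subalgebra.smul_mem _ hx a)
  obtain ⟨b, hb⟩ := exists_eq_algebraMap_of_ordAt_nonneg hg hB (by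
    by_cases h0 : f - a • x = 0
    · simp [h0, ordAt_zero]
    by_contra! hlt
    have h1 := poleOrder_two_le hg (natAbs_ordAt_mem_poleOrders hg hB h0) (by lia)
    have h2 := ha h0
    lia)
  exact ⟨a, b, by rw [hb]; ring⟩

/-! ### A basis of the ring of functions regular away from `O` -/

/-- The least pole order in each residue class modulo a positive pole order. -/
theorem exists_apery (hg : 1 ≤ C.genus) (O : C.Point) {d : ℕ} (hd : 0 < d) :
    ∃ w : Fin d → ℕ, ∀ i, w i ∈ C.poleOrders O ∧ w i % d = i ∧
      ∀ n ∈ C.poleOrders O, n % d = i → w i ≤ n := by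
  classical
  have (i : Fin d) : ∃ n, n ∈ C.poleOrders O ∧ n % d = i := by
    -- A class containing no pole order would consist of infinitely many gaps.
    by_contra! h
    refine Set.infinite_of_injective_forall_mem (f := fun j : ℕ => i + d * j) (fun a b hab => ?_)
      (s := (C.poleOrders O)ᶜ) (fun j hj => h _ hj ?_) (finite_compl_poleOrders hg O)
    · simpa [hd.ne'] using hab
    · simp [Nat.mod_eq_of_lt i.2]
  exact ⟨fun i => Nat.find (this i), fun i => ⟨(Nat.find_spec (this i)).1,
    (Nat.find_spec (this i)).2, fun n hn hni => Nat.find_min' (this i) ⟨hn, hni⟩⟩⟩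

/-- The sum of the least pole orders in the residue classes. -/
theorem sum_apery_le (hg : 1 ≤ C.genus) {d : ℕ} (hd : 0 < d) {w : Fin d → ℕ}
    (hw : ∀ i, w i % d = i) (hmin : ∀ i : Fin d, ∀ n ∈ C.poleOrders O, n % d = (i : ℕ) → w i ≤ n) :
    2 * ∑ i, w i ≤ d * (2 * C.genus + d - 1) := by
  classical
  -- For `a < w i / d` the number `i + d * a` lies below the least pole order of its class, so it is
  -- a gap. These numbers are distinct.
  have h1 : ∑ i, w i / d ≤ C.genus := by
    have hinj : Set.InjOn (fun q : (_ : Fin d) × ℕ => (q.1 : ℕ) + d * q.2)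
        (Finset.univ.sigma fun i => Finset.range (w i / d)) := by
      rintro ⟨i, a⟩ - ⟨j, b⟩ - h
      simp only at h
      have hij : (i : ℕ) = j := by
        have := congrArg (· % d) h
        simpa [Nat.mod_eq_of_lt i.2, Nat.mod_eq_of_lt j.2] using this
      obtain rfl := Fin.ext hij
      have hab : a = b := by simpa [hd.ne'] using h
      rw [hab]
    have h2 := card_gaps_le (O := O) hg (Finset.image (fun q : (_ : Fin d) × ℕ => (q.1 : ℕ) + d * q.2)
        (Finset.univ.sigma fun i => Finset.range (w i / d))) (by
      intro n hn hnS
      obtain ⟨⟨i, a⟩, hia, rfl⟩ := Finset.mem_image.mp hn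
      simp only [Finset.mem_sigma, Finset.mem_univ, Finset.mem_range, true_and] at hia
      have := hmin i _ hnS (by simp [Nat.mod_eq_of_lt i.2])
      have h3 := Nat.div_add_mod (w i) d
      rw [hw] at h3
      have h4 : d * a < d * (w i / d) := Nat.mul_lt_mul_of_pos_left hia hd
      simp only at this
      lia)
    rw [Finset.card_image_of_injOn hinj, Finset.card_sigma] at h2
    simpa using h2
  have h2 : ∑ i, w i = d * ∑ i, w i / d + ∑ i : Fin d, (i : ℕ) := by
    rw [Finset.mul_sum, ← Finset.sum_add_distrib]
    refine Finset.sum_congr rfl fun i _ => ?_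
    rw [← hw i, Nat.div_add_mod]
  have h3 : (∑ i : Fin d, (i : ℕ)) * 2 = d * (d - 1) := by
    rw [Fin.sum_univ_eq_sum_range fun i => i, Finset.sum_range_id_mul_two]
  have h4 : d * (2 * C.genus + d - 1) = 2 * (d * C.genus) + d * (d - 1) := by
    obtain ⟨e, rfl⟩ : ∃ e, d = e + 1 := ⟨d - 1, by lia⟩
    simp only [Nat.add_sub_cancel]
    rw [← Nat.add_assoc, Nat.add_sub_cancel]
    ring
  have h5 := Nat.mul_le_mul_left d h1
  lia

section Basis

variable [Algebra k[X] (C.regularAway O)] [IsScalarTower k k[X] (C.regularAway O)]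

/-- Distinct powers of `x` have distinct pole orders, so the leading term dominates. -/
lemma ordAt_algebraMap_polynomial {d : ℕ} (hd : 0 < d)
    (hx : C.ordAt O (algebraMap k[X] (C.regularAway O) Polynomial.X) = -(d : ℤ)) {p : k[X]} (hp : p ≠ 0) :
    (algebraMap k[X] (C.regularAway O) p : C.FunctionField) ≠ 0 ∧
      C.ordAt O (algebraMap k[X] (C.regularAway O) p) = -(d * p.natDegree : ℤ) := by
  set x := algebraMap k[X] (C.regularAway O) Polynomial.X
  have hx0 : (x : C.FunctionField) ≠ 0 := fun h => by
    rw [h, ordAt_zero] at hx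
    lia
  have hsum : (algebraMap k[X] (C.regularAway O) p : C.FunctionField) =
      ∑ i ∈ Finset.range (p.natDegree + 1), p.coeff i • (x : C.FunctionField) ^ i := by
    conv_lhs => rw [p.as_sum_range]
    rw [map_sum, AddSubmonoidClass.coe_finsetSum]
    refine Finset.sum_congr rfl fun i _ => ?_
    rw [← smul_X_eq_monomial, ← IsScalarTower.coe_toAlgHom' k, map_smul, map_pow]
    rfl
  have hord (i : ℕ) (hi : p.coeff i ≠ 0) :
      C.ordAt O (p.coeff i • (x : C.FunctionField) ^ i) = -(d * i : ℤ) := by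
    rw [ordAt_smul hi, ordAt_pow, hx]
    ring
  have hlead : p.coeff p.natDegree ≠ 0 := by simpa
  rw [hsum, ← hord _ hlead]
  refine ordAt_sum_of_mem (by simp) (by simp [hp, hx0]) fun j hj hne => ?_
  by_cases hc : p.coeff j = 0
  · simp [hc]
  intro _
  rw [hord _ hlead, hord _ hc]
  have h1 : j < p.natDegree := by
    have := Finset.mem_range.mp hj
    lia
  have h2 : (d : ℤ) * (j + 1) ≤ d * p.natDegree := by gcongr; lia
  have h3 : (1 : ℤ) ≤ d := by exact_mod_cast hd
  linarith

variable {d : ℕ} {w : Fin d → ℕ} {b : Fin d → C.regularAway O}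

/-- A combination of functions whose pole orders are distinct modulo `d` has as large a pole as
each of its terms. -/
theorem ordAt_sum_smul_le (hd : 0 < d)
    (hx : C.ordAt O (algebraMap k[X] (C.regularAway O) Polynomial.X) = -(d : ℤ))
    (hw : ∀ i, w i % d = i) (hb0 : ∀ i, b i ≠ 0) (hb : ∀ i, C.ordAt O (b i) = -(w i : ℤ))
    (p : Fin d → k[X]) {i : Fin d} (hi : p i ≠ 0) :
    ∑ j, p j • b j ≠ 0 ∧
      C.ordAt O (∑ j, p j • b j : C.regularAway O) ≤ -(d * (p i).natDegree + w i : ℤ) := by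
  classical
  have hterm (j) (hj : p j ≠ 0) : ((p j • b j : C.regularAway O) : C.FunctionField) ≠ 0 ∧
      C.ordAt O (p j • b j : C.regularAway O) = -((d * (p j).natDegree + w j : ℕ) : ℤ) := by
    obtain ⟨h1, h2⟩ := ordAt_algebraMap_polynomial hd hx hj
    have h3 : (b j : C.FunctionField) ≠ 0 := by simpa using hb0 j
    rw [Algebra.smul_def, MulMemClass.coe_mul]
    refine ⟨mul_ne_zero h1 h3, ?_⟩
    rw [ordAt_mul h1 h3, h2, hb]
    push_cast
    ring
  obtain ⟨m, hm, hmax⟩ := Finset.exists_max_image (Finset.univ.filter fun j => p j ≠ 0)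
    (fun j => d * (p j).natDegree + w j) ⟨i, by simpa⟩
  simp only [Finset.mem_filter, Finset.mem_univ, true_and] at hm hmax
  obtain ⟨h1, h2⟩ := ordAt_sum_of_mem (P := O) (s := Finset.univ)
    (g := fun j => ((p j • b j : C.regularAway O) : C.FunctionField)) (Finset.mem_univ m)
    (hterm m hm).1 (by
      intro j _ hj
      by_cases hpj : p j = 0
      · simp [hpj]
      intro _
      rw [(hterm m hm).2, (hterm j hpj).2]
      have h3 := hmax j hpj
      have h4 : d * (p j).natDegree + w j ≠ d * (p m).natDegree + w m := by
        intro h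
        have := congrArg (· % d) h
        simp only [Nat.mul_add_mod, hw] at this
        exact hj (Fin.ext this)
      lia)
  rw [← AddSubmonoidClass.coe_finsetSum] at h1 h2
  refine ⟨fun h => h1 (by rw [h]; rfl), ?_⟩
  rw [h2, (hterm m hm).2]
  have := hmax i hi
  lia

/-- Functions with the least pole order in each residue class modulo the pole order `d` of `x` form
a basis over `k[x]`. -/
theorem exists_basis (hg : 1 ≤ C.genus) (hd : 0 < d)
    (hx : C.ordAt O (algebraMap k[X] (C.regularAway O) Polynomial.X) = -(d : ℤ))
    (hw : ∀ i, w i % d = i) (hmin : ∀ i : Fin d, ∀ n ∈ C.poleOrders O, n % d = (i : ℕ) → w i ≤ n)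
    (hb0 : ∀ i, b i ≠ 0) (hb : ∀ i, C.ordAt O (b i) = -(w i : ℤ)) :
    ∃ B : Module.Basis (Fin d) k[X] (C.regularAway O), ⇑B = b := by
  have hli : LinearIndependent k[X] b := by
    rw [Fintype.linearIndependent_iff]
    intro p hp i
    by_contra hi
    exact (ordAt_sum_smul_le hd hx hw hb0 hb p hi).1 hp
  -- Induction on the pole order `n`: in the class of `n` modulo `d`, some `x ^ m * b i` has pole
  -- order exactly `n`, and subtracting a multiple of it lowers the pole.
  have hspan : ∀ n : ℕ, ∀ f : C.regularAway O, (C.ordAt O f).natAbs = n →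
      f ∈ Submodule.span k[X] (Set.range b) := by
    intro n
    induction n using Nat.strong_induction_on with
    | _ n ih =>
    intro f hf
    by_cases h0 : f = 0
    · simp [h0]
    have hf0 : (f : C.FunctionField) ≠ 0 := by simpa using h0
    have hnS : n ∈ C.poleOrders O := hf ▸ natAbs_ordAt_mem_poleOrders hg f.2 hf0
    set i : Fin d := ⟨n % d, Nat.mod_lt _ hd⟩
    have hle : w i ≤ n := hmin i n hnS rfl
    obtain ⟨m, hm⟩ : ∃ m, n = w i + d * m :=
      ⟨(n - w i) / d, by
        rw [Nat.mul_div_cancel' ((Nat.modEq_iff_dvd' hle).mp (hw i))]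
        lia⟩
    set y : C.regularAway O := (Polynomial.X ^ m : k[X]) • b i
    obtain ⟨h1, h2⟩ := ordAt_algebraMap_polynomial hd hx (pow_ne_zero m (X_ne_zero (R := k)))
    have h3 : (b i : C.FunctionField) ≠ 0 := by simpa using hb0 i
    have hy : (y : C.FunctionField) =
      (algebraMap k[X] (C.regularAway O) (Polynomial.X ^ m) : C.FunctionField) * b i := by
      simp only [y, Algebra.smul_def, MulMemClass.coe_mul]
    have hy0 : (y : C.FunctionField) ≠ 0 := hy ▸ mul_ne_zero h1 h3
    have hfO := ordAt_nonpos hg f.2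
    have hyO : C.ordAt O y = C.ordAt O f := by
      rw [hy, ordAt_mul h1 h3, h2, hb, natDegree_X_pow]
      have : (n : ℤ) = w i + d * m := by exact_mod_cast hm
      lia
    obtain ⟨c, hc⟩ := exists_sub_smul_mem_ordGE (mem_ordGE_ordAt (f : C.FunctionField) O) hy0 hyO
    have hsplit : f = (f - c • y) + c • y := by ring
    rw [hsplit]
    refine Submodule.add_mem _ ?_ ?_
    · by_cases hr : f - c • y = 0
      · simp [hr]
      have h4 := hc (by simpa [Subtype.ext_iff] using hr)
      have h5 := ordAt_nonpos hg (f - c • y).2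
      simp only [AddSubgroupClass.coe_sub, SetLike.val_smul] at h5
      refine ih _ ?_ _ rfl
      simp only [AddSubgroupClass.coe_sub, SetLike.val_smul]
      lia
    · rw [← algebraMap_smul k[X] c y]
      exact Submodule.smul_mem _ _ (Submodule.smul_mem _ _ (Submodule.subset_span ⟨i, rfl⟩))
  exact ⟨.mk hli fun f _ => hspan _ f rfl, Module.Basis.coe_mk _ _⟩

end Basis

end

end SmoothProperCurve

open Polynomial

/-! ### Discriminants over a polynomial ring -/

section Discriminant

variable {k B ι : Type*} [Field k] [CommRing B] [Algebra k[X] B] [Fintype ι] [DecidableEq ι]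

/-- The trace of an element which is nilpotent modulo `X - c` is divisible by `X - c`. -/
theorem Polynomial.X_sub_C_dvd_trace (b : Module.Basis ι k[X] B) {c : k} {y : B} {n : ℕ}
    (h : algebraMap k[X] B (X - C c) ∣ y ^ n) : X - C c ∣ Algebra.trace k[X] B y := by
  obtain ⟨z, hz⟩ := h
  let φ : Matrix ι ι k[X] →+* Matrix ι ι k := (evalRingHom c).mapMatrix
  -- Modulo `X - c` the matrix of multiplication by `y` becomes nilpotent, so its trace is zero.
  have h1 : φ (Algebra.leftMulMatrix b y) ^ n = 0 := by
    rw [← map_pow, ← map_pow, hz, map_mul, map_mul, AlgHom.commutes]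
    convert zero_mul _
    ext i j
    simp [φ, Matrix.algebraMap_matrix_apply]
    split_ifs <;> simp
  have h2 := (Matrix.isNilpotent_trace_of_isNilpotent ⟨n, h1⟩).eq_zero
  rw [dvd_iff_isRoot, IsRoot.def, Algebra.trace_eq_matrix_trace b, ← h2]
  exact (AddMonoidHom.map_trace (evalRingHom c).toAddMonoidHom _)

/-- If all rows but one are, up to multiples of that one, divisible by `a`, then the determinant
is divisible by `a ^ (n - 1)`. -/
theorem Matrix.pow_dvd_det {R : Type*} [CommRing R] (M : Matrix ι ι R) (a : R) (i₀ : ι) (s : ι → R)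
    (h : ∀ i ≠ i₀, ∀ j, a ∣ M i j - s i * M i₀ j) : a ^ (Fintype.card ι - 1) ∣ M.det := by
  choose! N hN using h
  let M' : Matrix ι ι R := Matrix.of fun i j => if i = i₀ then M i₀ j else a * N i j
  have h1 : M.det = M'.det := by
    refine Matrix.det_eq_of_forall_row_eq_smul_add_const (fun i => if i = i₀ then 0 else s i) i₀
      (by simp) fun i j => ?_
    by_cases hi : i = i₀
    · simp [M', hi]
    · simp [M', hi, ← hN i hi j]
  let v : ι → R := fun i => if i = i₀ then 1 else a
  let N' : Matrix ι ι R := Matrix.of fun i j => if i = i₀ then M i₀ j else N i j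
  have h2 : M' = Matrix.of fun i j => v i * N' i j := by
    ext i j
    by_cases hi : i = i₀ <;> simp [M', N', v, hi]
  rw [h1, h2, Matrix.det_mul_column]
  refine Dvd.dvd.mul_right ?_ _
  simp only [v, Finset.prod_ite, Finset.prod_const_one, one_mul, Finset.prod_const]
  rw [Finset.filter_ne', Finset.card_erase_of_mem (Finset.mem_univ _), Finset.card_univ]

/-- A bound for the degree of a determinant whose entries are bounded by weights. -/
theorem Polynomial.mul_natDegree_det_le (M : Matrix ι ι k[X]) (w : ι → ℕ) (d : ℕ)
    (h : ∀ i j, d * (M i j).natDegree ≤ w i + w j) : d * M.det.natDegree ≤ 2 * ∑ i, w i := by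
  rcases Nat.eq_zero_or_pos d with rfl | hd
  · simp
  rw [mul_comm, ← Nat.le_div_iff_mul_le hd, Matrix.det_apply]
  refine natDegree_sum_le_of_forall_le _ _ fun σ _ => ?_
  rw [Nat.le_div_iff_mul_le hd, mul_comm]
  calc d * (Equiv.Perm.sign σ • ∏ i, M (σ i) i).natDegree
      ≤ d * ∑ i, (M (σ i) i).natDegree := by
        gcongr
        refine (natDegree_smul_le _ _).trans (natDegree_prod_le _ _)
    _ ≤ ∑ i, (w (σ i) + w i) := by
        rw [Finset.mul_sum]
        exact Finset.sum_le_sum fun i _ => h _ _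
    _ = 2 * ∑ i, w i := by
        rw [Finset.sum_add_distrib, Equiv.sum_comp σ w, two_mul]

/-- More than `rank B` elements are linearly dependent modulo `X - c`. -/
theorem Polynomial.exists_X_sub_C_dvd_sum {ι : Type*} [Fintype ι] [Algebra k B]
    [IsScalarTower k k[X] B] {κ : Type*} [Fintype κ] (b : Module.Basis ι k[X] B) (c : k) (hcard : Fintype.card ι < Fintype.card κ)
    (v : κ → B) : ∃ γ : κ → k, γ ≠ 0 ∧ algebraMap k[X] B (X - C c) ∣ ∑ j, γ j • v j := by
  -- Coordinates evaluated at `c` live in a space of dimension `Fintype.card ι`; a relation there is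
  -- a relation modulo `X - c`.
  have hdep : ¬ LinearIndependent k fun (j : κ) (i : ι) => (b.repr (v j) i).eval c := fun h => by
    have := h.fintype_card_le_finrank
    rw [Module.finrank_fintype_fun_eq_card] at this
    lia
  rw [Fintype.linearIndependent_iff] at hdep
  push Not at hdep
  obtain ⟨γ, hγ, j, hj⟩ := hdep
  refine ⟨γ, fun h => hj (congrFun h j), ?_⟩
  have hroot (i : ι) : X - C c ∣ b.repr (∑ j, γ j • v j) i := by
    rw [dvd_iff_isRoot, IsRoot.def]
    have := congrFun hγ i
    simp only [Finset.sum_apply, Pi.smul_apply, smul_eq_mul, Pi.zero_apply] at this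
    rw [← this, map_sum, Finsupp.finsetSum_apply, eval_finsetSum]
    refine Finset.sum_congr rfl fun j _ => ?_
    rw [← algebraMap_smul k[X] (γ j) (v j), map_smul]
    simp
  rw [← b.sum_repr (∑ j, γ j • v j)]
  refine Finset.dvd_sum fun i _ => ?_
  obtain ⟨q, hq⟩ := hroot i
  rw [Algebra.smul_def, hq, map_mul]
  exact (Dvd.intro _ rfl).mul_right _

end Discriminant

/-! ### Separability -/

/-- Let `L / F` be a finite extension of fields of characteristic `p` with `F = Fᵖ(x)`. If `x` is
not a `p`-th power in `L`, then `L / F` is separable. -/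
theorem isSeparable_of_notMem_frobenius {F L : Type*} [Field F] [Field L] [Algebra F L]
    [FiniteDimensional F L] (p : ℕ) [Fact p.Prime] [CharP F p] [CharP L p] (x : F)
    (hF : ∀ S : Subfield F, (frobenius F p).fieldRange ≤ S → x ∈ S → S = ⊤)
    (hx : ∀ y : L, y ^ p ≠ algebraMap F L x) : Algebra.IsSeparable F L := by
  have hp : p.Prime := Fact.out
  set F₀ := (frobenius F p).fieldRange
  set L₀ := (frobenius L p).fieldRange
  set F' := (algebraMap F L).fieldRange
  set x' := algebraMap F L x
  -- `[F : Fᵖ] ≤ p`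
  have hint : IsIntegral F₀ x := by
    refine .of_pow hp.pos ?_
    exact isIntegral_algebraMap (R := F₀) (x := (⟨x ^ p, x, rfl⟩ : F₀))
  have hFtop : IntermediateField.adjoin F₀ {x} = ⊤ := by
    rw [← IntermediateField.toSubfield_inj, IntermediateField.top_toSubfield]
    refine hF _ (fun y hy => ?_) (IntermediateField.mem_adjoin_simple_self F₀ x)
    exact (IntermediateField.adjoin F₀ {x}).algebraMap_mem ⟨y, hy⟩
  have hF1 : Module.finrank F₀ F = (minpoly F₀ x).natDegree := by
    rw [← IntermediateField.adjoin.finrank hint, hFtop, IntermediateField.finrank_top']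
  have hF2 : Module.finrank F₀ F ≤ p := by
    rw [hF1]
    refine (natDegree_le_natDegree (minpoly.min F₀ x (monic_X_pow_sub_C (⟨x ^ p, x, rfl⟩ : F₀) hp.ne_zero)
      ?_)).trans (natDegree_X_pow_sub_C).le
    rw [map_sub, map_pow, aeval_X, aeval_C]
    exact sub_self _
  have hF3 : 0 < Module.finrank F₀ F := hF1 ▸ minpoly.natDegree_pos hint
  -- `[L : Lᵖ] = [F : Fᵖ]`
  have hfin : Module.finrank L₀ L = Module.finrank F₀ F := by
    -- The degree `[L : Fᵖ]` is computed through `F` and through `Lᵖ`. Frobenius gives `[Lᵖ : Fᵖ] =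
    -- [L : F]`, and this factor cancels.
    have e1 : F'.map (frobenius L p) = F₀.map (algebraMap F L) := by
      ext z
      simp only [F', F₀, Subfield.mem_map, RingHom.mem_fieldRange]
      constructor
      · rintro ⟨_, ⟨y, rfl⟩, rfl⟩
        exact ⟨_, ⟨y, rfl⟩, by simp [frobenius_def]⟩
      · rintro ⟨_, ⟨y, rfl⟩, rfl⟩
        exact ⟨_, ⟨y, rfl⟩, by simp [frobenius_def]⟩
    have e2 : (⊤ : Subfield F).map (algebraMap F L) = F' := (RingHom.fieldRange_eq_map _).symm
    have e3 : (⊤ : Subfield L).map (frobenius L p) = L₀ := (RingHom.fieldRange_eq_map _).symm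
    have h1 : Subfield.relfinrank (F₀.map (algebraMap F L)) F' = Module.finrank F₀ F := by
      rw [← e2, Subfield.relfinrank_map_map, Subfield.relfinrank_top_right]
    have h2 : Subfield.relfinrank (F'.map (frobenius L p)) L₀ = Module.finrank F' L := by
      rw [← e3, Subfield.relfinrank_map_map, Subfield.relfinrank_top_right]
    have h3 := Subfield.relfinrank_mul_finrank_top (A := F₀.map (algebraMap F L)) (B := F') (by
      rw [← e2]; exact (Subfield.gc_map_comap _).monotone_l le_top)
    have h4 := Subfield.relfinrank_mul_finrank_top (A := F'.map (frobenius L p)) (B := L₀) (by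
      rw [← e3]; exact (Subfield.gc_map_comap _).monotone_l le_top)
    rw [h1] at h3
    rw [h2, e1, ← h3, mul_comm] at h4
    have h5 : 0 < Module.finrank F' L := by
      let : Algebra F F' := (algebraMap F L).rangeRestrictField.toAlgebra
      have : IsScalarTower F F' L := .of_algebraMap_eq' rfl
      have : FiniteDimensional F' L := .of_restrictScalars_finite F F' L
      exact Module.finrank_pos
    exact Nat.eq_of_mul_eq_mul_right h5 h4
  -- `L = Lᵖ(x)`
  have hLtop : IntermediateField.adjoin L₀ {x'} = ⊤ := by
    have hfd : FiniteDimensional L₀ L := .of_finrank_pos (hfin ▸ hF3)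
    refine IntermediateField.eq_of_le_of_finrank_le le_top ?_
    rw [IntermediateField.finrank_top', hfin]
    refine hF2.trans_eq ?_
    -- As Frobenius is injective, a `p`-th root of `x' ^ p` in `Lᵖ` would be `x'` itself, which is
    -- not in `Lᵖ`. Hence `Lᵖ(x')` has degree `p`, at least that of `L`.
    have hirr : Irreducible (X ^ p - C (⟨x' ^ p, x', rfl⟩ : L₀)) := by
      refine X_pow_sub_C_irreducible_of_prime hp fun ⟨z, y, hy⟩ hz => hx y ?_
      have hz' : frobenius L p z = frobenius L p x' := congrArg Subtype.val hz
      rw [← frobenius_inj L p hz', ← hy, frobenius_def]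
    rw [IntermediateField.adjoin.finrank (Algebra.IsIntegral.isIntegral x'),
      ← minpoly.eq_of_irreducible_of_monic hirr (by
        rw [map_sub, map_pow, aeval_X, aeval_C]
        exact sub_self _)
        (monic_X_pow_sub_C _ hp.ne_zero), natDegree_X_pow_sub_C]
  -- the exponent of `L` over the separable closure of `F` is zero
  set E := separableClosure F L
  have hexp : IsPurelyInseparable.exponent E L = 0 := by
    by_contra hne
    obtain ⟨m, hm⟩ := Nat.exists_eq_succ_of_ne_zero hne
    obtain ⟨a, ha⟩ := IsPurelyInseparable.exponent_min' (K := E) (L := L) p (e := m) (by lia)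
    refine ha ?_
    -- Elements whose `p ^ m`-th power is separable over `F`. If the exponent were `m + 1`, this
    -- field would contain `Lᵖ` and `x'`, hence be all of `L`, so exponent `m` would already
    -- suffice.
    let S : Subfield L := E.toSubfield.comap (iterateFrobenius L p m)
    have hS : L₀ ≤ S := by
      rintro _ ⟨y, rfl⟩
      obtain ⟨z, hz⟩ := IsPurelyInseparable.exponent_def' (K := E) p y
      rw [Subfield.mem_comap, iterateFrobenius_def, frobenius_def, ← pow_mul, ← pow_succ',
        ← Nat.succ_eq_add_one, ← hm, ← hz]
      exact z.2
    let S' : IntermediateField L₀ L := S.toIntermediateField fun z => hS z.2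
    have hS' : IntermediateField.adjoin L₀ {x'} ≤ S' := by
      rw [IntermediateField.adjoin_simple_le_iff]
      change iterateFrobenius L p m x' ∈ E
      rw [iterateFrobenius_def]
      exact pow_mem (E.algebraMap_mem x) _
    rw [hLtop] at hS'
    have haS : iterateFrobenius L p m a ∈ E := hS' (IntermediateField.mem_top (x := a))
    exact ⟨⟨_, haS⟩, by rw [← iterateFrobenius_def]; rfl⟩
  rw [← separableClosure.eq_top_iff, eq_top_iff]
  intro a _
  obtain ⟨z, hz⟩ := IsPurelyInseparable.exponent_def' (K := E) p a
  rw [hexp, pow_zero, pow_one] at hz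
  exact hz ▸ z.2

attribute [local instance] FractionRing.liftAlgebra FractionRing.isScalarTower_liftAlgebra in
/-- If the discriminant of `B` over `k[x]` is zero, then `x` is a `p`-th power in the field of
fractions of `B`. -/
theorem exists_pow_eq_of_discr_eq_zero {k B ι : Type*} [Field k] [IsAlgClosed k] [CommRing B]
    [IsDomain B] [Algebra k[X] B] [Fintype ι] [DecidableEq ι]
    (b : Module.Basis ι k[X] B) (h : Algebra.discr k[X] b = 0) :
    ∃ p : ℕ, p.Prime ∧ ∃ y : FractionRing B,
      y ^ p = algebraMap B (FractionRing B) (algebraMap k[X] B X) := by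
  have : Module.Free k[X] B := .of_basis b
  have : Module.Finite k[X] B := .of_basis b
  have : FaithfulSMul k[X] B := inferInstance
  set F := FractionRing k[X]
  set L := FractionRing B
  let b' : Module.Basis ι F L := b.localizationLocalization F (nonZeroDivisors k[X]) L
  have : FiniteDimensional F L := .of_basis b'
  have hdisc : Algebra.discr F b' = 0 := by
    rw [Algebra.discr_localizationLocalization, h, map_zero]
  have hsep : ¬ Algebra.IsSeparable F L := fun _ => Algebra.discr_not_zero_of_basis F b' hdisc
  obtain ⟨p, hp⟩ := CharP.exists k
  rcases CharP.char_is_prime_or_zero k p with hprime | rfl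
  · have : Fact p.Prime := ⟨hprime⟩
    have : CharP F p := charP_of_injective_algebraMap (algebraMap k F).injective p
    have : CharP L p := charP_of_injective_algebraMap (algebraMap F L).injective p
    refine ⟨p, hprime, ?_⟩
    by_contra! hne
    refine hsep (isSeparable_of_notMem_frobenius p (algebraMap k[X] F X) (fun S hS hX => ?_) ?_)
    -- Every coefficient is a `p`-th power in the algebraically closed field `k`, so `p`-th powers
    -- together with `X` generate `k(X)`.
    · have hpoly (q : k[X]) : algebraMap k[X] F q ∈ S := by
        induction q using Polynomial.induction_on' with
        | add q r hq hr => rw [map_add]; exact S.add_mem hq hr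
        | monomial n c =>
          obtain ⟨c', hc'⟩ := IsAlgClosed.exists_pow_nat_eq c hprime.pos
          rw [← C_mul_X_pow_eq_monomial, map_mul, map_pow, ← hc', C_pow, map_pow]
          exact S.mul_mem (hS ⟨_, rfl⟩) (pow_mem hX n)
      refine eq_top_iff.mpr fun z _ => ?_
      obtain ⟨q, r, -, rfl⟩ := IsFractionRing.div_surjective (A := k[X]) z
      exact S.div_mem (hpoly q) (hpoly r)
    · intro y hy
      refine hne y (hy.trans ?_)
      rw [← IsScalarTower.algebraMap_apply, ← IsScalarTower.algebraMap_apply]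
  · have : CharZero k := CharP.charP_to_charZero k
    have : CharZero F := charZero_of_injective_algebraMap (algebraMap k F).injective
    exact (hsep inferInstance).elim

open AlgebraicGeometry CategoryTheory Polynomial

namespace SmoothProperCurve

noncomputable section

variable {k : Type*} [Field k] {C : SmoothProperCurve k} [IsAlgClosed k] {O : C.Point}

/-! ### The discriminant of the ring of functions regular away from `O` -/

lemma notMem_range_algebraMap {x : C.FunctionField} (hx : C.ordAt O x ≠ 0) :
    x ∉ (algebraMap k C.FunctionField).range := by
  rintro ⟨c, rfl⟩
  exact hx (ordAt_algebraMap c O)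

/-- Prescribing a function away from `O` modulo a nonzero function `h`. -/
theorem exists_sub_mem_ordGE (hg : 1 ≤ C.genus) {x h : C.FunctionField} (hx : x ∈ C.regularAway O)
    (hxO : C.ordAt O x ≠ 0) (h0 : h ≠ 0) (a : C.Point →₀ C.FunctionField) :
    ∃ f : C.FunctionField, ∀ P ≠ O, f - a P ∈ C.ordGE P (C.ordAt P h) := by
  have := C.finite_H1 hg
  -- Dividing by `h` turns the congruence modulo `h` into plain regularity.
  obtain ⟨f, hf⟩ : a.mapRange (h⁻¹ * ·) (mul_zero _) ∈ C.principalMod {O} := by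
    rw [principalMod_eq_top (S := {O}) (notMem_range_algebraMap hxO) fun P hP => hx P hP]
    exact Submodule.mem_top
  refine ⟨h * f, fun P hP => ?_⟩
  have := mul_mem_ordGE (mem_ordGE_ordAt h P) (hf P hP)
  rw [add_zero, Finsupp.mapRange_apply] at this
  convert this using 1
  field_simp

section

variable [Algebra k[X] (C.regularAway O)] [IsScalarTower k k[X] (C.regularAway O)] {d : ℕ}

lemma algebraMap_X_sub_C (c : k) :
    (algebraMap k[X] (C.regularAway O) (Polynomial.X - Polynomial.C c) : C.FunctionField) =
      algebraMap k[X] (C.regularAway O) Polynomial.X - algebraMap k C.FunctionField c := by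
  rw [map_sub, ← algebraMap_eq, ← IsScalarTower.algebraMap_apply]
  rfl

/-- A basis of the ring of functions regular away from `O` with controlled pole orders. -/
theorem exists_basis_apery (hg : 1 ≤ C.genus) (hd : 0 < d)
    (hx : C.ordAt O (algebraMap k[X] (C.regularAway O) Polynomial.X) = -(d : ℤ)) :
    ∃ (w : Fin d → ℕ) (b : Module.Basis (Fin d) k[X] (C.regularAway O)),
      (∀ i, w i % d = i) ∧ (∀ i, C.ordAt O (b i) = -(w i : ℤ)) ∧ b ⟨0, hd⟩ = 1 ∧
      2 * ∑ i, w i ≤ d * (2 * C.genus + d - 1) := by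
  classical
  obtain ⟨w, hw⟩ := exists_apery hg O hd
  have hmod (i) := (hw i).2.1
  have hmin (i) := (hw i).2.2
  let i₀ : Fin d := ⟨0, hd⟩
  have hw0 : w i₀ = 0 := Nat.le_zero.mp (hmin i₀ 0 zero_mem_poleOrders (by simp [i₀]))
  have (i : Fin d) : ∃ f : C.regularAway O, f ≠ 0 ∧ C.ordAt O f = -(w i : ℤ) ∧
      (i = i₀ → f = 1) := by
    by_cases hi : i = i₀
    · subst hi
      exact ⟨1, one_ne_zero, by rw [hw0]; exact ordAt_one O, fun _ => rfl⟩
    · obtain ⟨f, h1, h2⟩ := mem_poleOrders_iff.mp (hw i).1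
      exact ⟨f, h1, h2, fun h => (hi h).elim⟩
  choose f hf0 hfO hf1 using this
  obtain ⟨b, rfl⟩ := exists_basis hg hd hx hmod hmin hf0 hfO
  exact ⟨w, b, hmod, hfO, hf1 i₀ rfl, sum_apery_le hg hd hmod hmin⟩

/-- If `x - c` vanishes at `P` to the order `d` of the pole of `x`, it has no other zero. -/
theorem ordAt_sub_eq_zero (hg : 1 ≤ C.genus) (b : Module.Basis (Fin d) k[X] (C.regularAway O))
    {x : C.FunctionField} (hxX : (algebraMap k[X] (C.regularAway O) Polynomial.X : _) = x)
    (hxO : C.ordAt O x ≠ 0) {P Q : C.Point} (hP : P ≠ O) (hQ : Q ≠ O) (hPQ : Q ≠ P) {c : k}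
    (hc : C.ordAt P (x - algebraMap k C.FunctionField c) = d) :
    C.ordAt Q (x - algebraMap k C.FunctionField c) = 0 := by
  classical
  have hx : x ∈ C.regularAway O := hxX ▸ SetLike.coe_mem _
  set h := x - algebraMap k C.FunctionField c
  have hh : h ∈ C.regularAway O := sub_mem hx (Subalgebra.algebraMap_mem _ c)
  have h0 : h ≠ 0 := fun h0 => notMem_range_algebraMap hxO ⟨c, (sub_eq_zero.mp h0).symm⟩
  have hreg (R) (hR : R ≠ O) : 0 ≤ C.ordAt R h := hh R hR h0
  by_contra hne
  have hQ1 : 1 ≤ C.ordAt Q h := by have := hreg Q hQ; lia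
  obtain ⟨t, ht⟩ := exists_ordAt_eq_one P
  have ht0 : t ≠ 0 := by rintro rfl; rw [ordAt_zero] at ht; lia
  -- Targets `1` at `Q` and `1, t, …, t^(d-1)` at `P`. Were `Q` a zero of `h` too, they would be
  -- independent modulo `h`; but these are `d + 1` elements and `B` has rank `d` over `k[x]`.
  let a : Option (Fin d) → C.Point →₀ C.FunctionField :=
    fun j => j.elim (Finsupp.single Q 1) fun i => Finsupp.single P (t ^ (i : ℕ))
  have ha (j) (R) : a j R ∈ C.ordGE R 0 := by
    rcases j with _ | i
    · simp only [a, Option.elim_none, Finsupp.single_apply]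
      split_ifs
      · simpa using algebraMap_mem_ordGE 1 R
      · exact Submodule.zero_mem _
    · simp only [a, Option.elim_some, Finsupp.single_apply]
      split_ifs with hR
      · subst hR
        intro _
        rw [ordAt_pow, ht]
        positivity
      · exact Submodule.zero_mem _
  choose f hf using fun j => exists_sub_mem_ordGE hg hx hxO h0 (a j)
  have hfB (j) : f j ∈ C.regularAway O := fun R hR => by
    rw [← sub_add_cancel (f j) (a j R)]
    exact Submodule.add_mem _ (ordGE_anti (hreg R hR) (hf j R hR)) (ha j R)
  obtain ⟨γ, hγ, z, hz⟩ := exists_X_sub_C_dvd_sum b c (κ := Option (Fin d)) (by simp)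
    fun j => (⟨f j, hfB j⟩ : C.regularAway O)
  have hsum (R) (hR : R ≠ O) : ∑ j, γ j • a j R ∈ C.ordGE R (C.ordAt R h) := by
    have e1 : ∑ j, γ j • f j = h * z := by
      have := congrArg Subtype.val hz
      rw [MulMemClass.coe_mul, algebraMap_X_sub_C, hxX, AddSubmonoidClass.coe_finsetSum] at this
      exact this
    have e2 : ∑ j, γ j • a j R = h * z - ∑ j, γ j • (f j - a j R) := by
      rw [← e1, ← Finset.sum_sub_distrib]
      exact Finset.sum_congr rfl fun j _ => by rw [← smul_sub, sub_sub_cancel]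
    rw [e2]
    refine Submodule.sub_mem _ ?_
      (Submodule.sum_mem _ fun j _ => Submodule.smul_mem _ _ (hf j R hR))
    simpa using mul_mem_ordGE (mem_ordGE_ordAt h R) (z.2 R hR)
  have hnone : γ none = 0 := by
    have := ordGE_anti hQ1 (hsum Q hQ)
    rw [Fintype.sum_option] at this
    simp only [a, Option.elim_none, Option.elim_some, Finsupp.single_eq_same,
      Finsupp.single_eq_of_ne hPQ, smul_zero, Finset.sum_const_zero, add_zero] at this
    by_contra hn
    have := this (by simpa)
    rw [ordAt_smul hn, ordAt_one] at this
    lia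
  have hsome (j : Fin d) : γ (some j) = 0 := by
    by_contra hj
    have := hsum P hP
    rw [Fintype.sum_option, hc] at this
    simp only [a, Option.elim_none, Option.elim_some, Finsupp.single_eq_same, hnone, zero_smul,
      zero_add] at this
    obtain ⟨m, hm, hmin⟩ := Finset.exists_min_image (Finset.univ.filter fun j => γ (some j) ≠ 0)
      (fun j : Fin d => (j : ℕ)) ⟨j, by simpa⟩
    simp only [Finset.mem_filter, Finset.mem_univ, true_and] at hm hmin
    have hord (i : Fin d) (hi : γ (some i) ≠ 0) : C.ordAt P (γ (some i) • t ^ (i : ℕ)) = i := by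
      rw [ordAt_smul hi, ordAt_pow, ht, mul_one]
    obtain ⟨h1, h2⟩ := ordAt_sum_of_mem (P := P) (s := Finset.univ)
      (g := fun i : Fin d => γ (some i) • t ^ (i : ℕ)) (Finset.mem_univ m) (by simp [hm, ht0]) (by
        intro i _ hi
        by_cases hγi : γ (some i) = 0
        · simp [hγi]
        intro _
        rw [hord m hm, hord i hγi]
        have := hmin i hγi
        have : (i : ℕ) ≠ m := fun h => hi (Fin.ext h)
        lia)
    have h3 := this h1
    rw [h2, hord m hm] at h3
    have := m.2
    lia
  exact hγ (funext fun j => by cases j <;> simp [hnone, hsome])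

/-- A point where `x - c` vanishes to the order `d` of the pole of `x` contributes at least `d - 1`
to the discriminant. -/
theorem pow_dvd_discr (hg : 1 ≤ C.genus) (b : Module.Basis (Fin d) k[X] (C.regularAway O))
    {x : C.FunctionField} (hxX : (algebraMap k[X] (C.regularAway O) Polynomial.X : _) = x)
    (hxO : C.ordAt O x ≠ 0) {i₀ : Fin d} (hb : b i₀ = 1) {P : C.Point} (hP : P ≠ O) {c : k}
    (hc : C.ordAt P (x - algebraMap k C.FunctionField c) = d) :
    (Polynomial.X - Polynomial.C c) ^ (d - 1) ∣ Algebra.discr k[X] b := by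
  have hx : x ∈ C.regularAway O := hxX ▸ SetLike.coe_mem _
  set h := x - algebraMap k C.FunctionField c
  have h0 : h ≠ 0 := fun h0 => notMem_range_algebraMap hxO ⟨c, (sub_eq_zero.mp h0).symm⟩
  choose s hs using fun i => exists_sub_mem_ordGE_one ((b i).2 P hP)
  -- From row `i` subtract the value `s i` of `b i` at `P` times the row of the basis element `1`.
  -- The new entries are traces of the elements `y` below.
  have := Matrix.pow_dvd_det (Algebra.traceMatrix k[X] b) (Polynomial.X - Polynomial.C c) i₀
    (fun i => Polynomial.C (s i)) fun i _ j => by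
      set y : C.regularAway O := (b i - algebraMap k (C.regularAway O) (s i)) * b j
      have hy : Algebra.traceMatrix k[X] b i j -
          Polynomial.C (s i) * Algebra.traceMatrix k[X] b i₀ j = Algebra.trace k[X] _ y := by
        have hy' : y = b i * b j - (Polynomial.C (s i) : k[X]) • b j := by
          simp only [y, sub_mul, ← Algebra.smul_def]
          rw [← algebraMap_smul k[X] (s i) (b j), algebraMap_eq]
        rw [Algebra.traceMatrix_apply, Algebra.traceMatrix_apply, Algebra.traceForm_apply,
          Algebra.traceForm_apply, hb, one_mul, hy', map_sub, map_smul, smul_eq_mul]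
      rw [hy]
      refine X_sub_C_dvd_trace b (n := d) ?_
      have hyP : (y : C.FunctionField) ∈ C.ordGE P 1 := by
        have := mul_mem_ordGE (hs i) ((b j).2 P hP)
        rwa [add_zero] at this
      -- Away from `O`, the only zero of `h` is `P`, of order `d`, and `y` vanishes there; so `y ^ d
      -- / h` is regular.
      refine ⟨⟨h⁻¹ * (y : C.FunctionField) ^ d, fun Q hQ => ?_⟩, ?_⟩
      · have h1 := mem_ordGE_ordAt h⁻¹ Q
        rw [ordAt_inv] at h1
        by_cases hQP : Q = P
        · subst hQP
          have h2 := mul_mem_ordGE h1 (pow_mem_ordGE hyP d)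
          rwa [hc, mul_one, neg_add_cancel] at h2
        · have h2 := mul_mem_ordGE h1 (pow_mem_ordGE (y.2 Q hQ) d)
          rwa [ordAt_sub_eq_zero hg b hxX hxO hP hQ hQP hc, mul_zero, neg_zero, add_zero] at h2
      · apply Subtype.ext
        rw [MulMemClass.coe_mul, algebraMap_X_sub_C, hxX]
        exact (mul_inv_cancel_left₀ h0 _).symm
  rwa [Fintype.card_fin] at this

/-- A bound for the degree of the discriminant in terms of the pole orders of the basis. -/
theorem mul_natDegree_discr_le (hd : 0 < d) (b : Module.Basis (Fin d) k[X] (C.regularAway O))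
    (hx : C.ordAt O (algebraMap k[X] (C.regularAway O) Polynomial.X) = -(d : ℤ))
    {w : Fin d → ℕ} (hw : ∀ i, w i % d = i) (hb : ∀ i, C.ordAt O (b i) = -(w i : ℤ)) :
    d * (Algebra.discr k[X] b).natDegree ≤ 2 * ∑ i, w i := by
  refine mul_natDegree_det_le _ w d fun i j => ?_
  rw [Algebra.traceMatrix_apply, Algebra.traceForm_apply, Algebra.trace_eq_matrix_trace b,
    Matrix.trace, mul_comm, ← Nat.le_div_iff_mul_le hd]
  refine natDegree_sum_le_of_forall_le _ _ fun l _ => ?_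
  rw [Nat.le_div_iff_mul_le hd, Matrix.diag_apply, Algebra.leftMulMatrix_eq_repr_mul, mul_comm]
  by_cases h0 : b.repr (b i * b j * b l) l = 0
  · simp [h0]
  have hb0 (i) : (b i : C.FunctionField) ≠ 0 := by simpa using b.ne_zero i
  -- The `l`-th diagonal entry is the coefficient of `b l` in `b i * b j * b l`, whose pole order is
  -- `w i + w j + w l`; the term `w l` cancels.
  have := (ordAt_sum_smul_le hd hx hw b.ne_zero hb (b.repr (b i * b j * b l)) h0).2
  rw [b.sum_repr, MulMemClass.coe_mul, MulMemClass.coe_mul,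
    ordAt_mul (mul_ne_zero (hb0 i) (hb0 j)) (hb0 l), ordAt_mul (hb0 i) (hb0 j), hb, hb, hb] at this
  lia

omit [IsScalarTower k k[X] (C.regularAway O)] in
/-- If `x` has the smallest possible pole order, the discriminant does not vanish. -/
theorem discr_ne_zero (hg : 1 ≤ C.genus) {ι : Type*} [Fintype ι] [DecidableEq ι]
    (b : Module.Basis ι k[X] (C.regularAway O)) {x : C.FunctionField}
    (hxX : (algebraMap k[X] (C.regularAway O) Polynomial.X : _) = x)
    (hxO : C.ordAt O x = -(C.poleOrder O 2 : ℤ)) : Algebra.discr k[X] b ≠ 0 := by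
  intro h
  have hpos := poleOrder_two_pos hg O
  obtain ⟨p, hp, y, hy⟩ := exists_pow_eq_of_discr_eq_zero b h
  let φ : FractionRing (C.regularAway O) →+* C.FunctionField :=
    IsFractionRing.lift (g := (C.regularAway O).val.toRingHom) Subtype.val_injective
  have hφ (z : C.regularAway O) : φ (algebraMap _ _ z) = z :=
    IsFractionRing.lift_algebraMap (g := (C.regularAway O).val.toRingHom) Subtype.val_injective z
  have hYp : φ y ^ p = x := by rw [← map_pow, hy, hφ, hxX]
  have hx : x ∈ C.regularAway O := hxX ▸ SetLike.coe_mem _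
  -- The `p`-th root `φ y` of `x` is again regular away from `O`, and its pole order `d / p` is
  -- positive and smaller than `d`.
  have hord (P) : p * C.ordAt P (φ y) = C.ordAt P x := by rw [← hYp, ordAt_pow]
  have hp2 : (2 : ℤ) ≤ p := by exact_mod_cast hp.two_le
  have hYB : φ y ∈ C.regularAway O := fun P hP _ => by
    have h1 : 0 ≤ C.ordAt P x :=
      isRegularAt_iff.mp (isRegularAt_iff_mem.mpr (hx P hP))
    rw [← hord] at h1
    exact nonneg_of_mul_nonneg_right h1 (by lia)
  have hO := hord O
  rw [hxO] at hO
  have hY0 : C.ordAt O (φ y) ≠ 0 := fun h => by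
    rw [h] at hO
    lia
  have h1 := ordAt_nonpos hg hYB
  have h2 := poleOrder_two_le hg (natAbs_ordAt_mem_poleOrders hg hYB (fun h => hY0 (by
    rw [h, ordAt_zero]))) (by lia)
  have h3 : 2 * -C.ordAt O (φ y) ≤ p * -C.ordAt O (φ y) :=
    mul_le_mul_of_nonneg_right hp2 (by lia)
  rw [mul_neg, mul_neg, hO] at h3
  lia

end

/-- If `x - c` vanishes at `P` to the order of the pole of `x`, its only pole, then it has no other
zero. -/
theorem ordAt_sub_eq_zero_of_ne (hg : 1 ≤ C.genus) {x : C.FunctionField} (hx : x ∈ C.regularAway O)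
    {d : ℕ} (hd : 0 < d) (hxO : C.ordAt O x = -(d : ℤ)) {P Q : C.Point} (hP : P ≠ O) (hQ : Q ≠ O)
    (hPQ : Q ≠ P) {c : k} (hc : C.ordAt P (x - algebraMap k C.FunctionField c) = d) :
    C.ordAt Q (x - algebraMap k C.FunctionField c) = 0 := by
  let : Algebra k[X] (C.regularAway O) := (aeval ⟨x, hx⟩).toAlgebra
  have : IsScalarTower k k[X] (C.regularAway O) :=
    .of_algebraMap_eq fun c => (aeval_C (⟨x, hx⟩ : C.regularAway O) c).symm
  have hxX : (algebraMap k[X] (C.regularAway O) Polynomial.X : C.FunctionField) = x :=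
    congrArg Subtype.val (aeval_X (R := k) (⟨x, hx⟩ : C.regularAway O))
  obtain ⟨w, b, -⟩ := exists_basis_apery hg hd (hxX.symm ▸ hxO)
  exact ordAt_sub_eq_zero hg b hxX (by lia) hP hQ hPQ hc

/-- The number of points other than `O` where `x` is totally ramified. -/
theorem card_mul_le (hg : 1 ≤ C.genus) {x : C.FunctionField} (hx : x ∈ C.regularAway O)
    (hxO : C.ordAt O x = -(C.poleOrder O 2 : ℤ)) (T : Finset C.Point)
    (hT : ∀ P ∈ T, P ≠ O ∧
      ∃ c : k, C.ordAt P (x - algebraMap k C.FunctionField c) = C.poleOrder O 2) :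
    T.card * (C.poleOrder O 2 - 1) ≤ 2 * C.genus + C.poleOrder O 2 - 1 := by
  classical
  set d := C.poleOrder O 2
  have hd : 0 < d := poleOrder_two_pos hg O
  let : Algebra k[X] (C.regularAway O) := (aeval ⟨x, hx⟩).toAlgebra
  have : IsScalarTower k k[X] (C.regularAway O) :=
    .of_algebraMap_eq fun c => (aeval_C (⟨x, hx⟩ : C.regularAway O) c).symm
  have hxX : (algebraMap k[X] (C.regularAway O) Polynomial.X : C.FunctionField) = x :=
    congrArg Subtype.val (aeval_X (R := k) (⟨x, hx⟩ : C.regularAway O))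
  have hxO0 : C.ordAt O x ≠ 0 := by lia
  obtain ⟨w, b, hmod, hb, hb1, hw⟩ := exists_basis_apery hg hd (hxX.symm ▸ hxO)
  have hdeg : (Algebra.discr k[X] b).natDegree ≤ 2 * C.genus + d - 1 :=
    Nat.le_of_mul_le_mul_left ((mul_natDegree_discr_le hd b (hxX.symm ▸ hxO) hmod hb).trans hw) hd
  have hne := discr_ne_zero hg b hxX hxO
  choose! c hc using fun P hP => (hT P hP).2
  have hdvd : ∏ P ∈ T, (Polynomial.X - Polynomial.C (c P)) ^ (d - 1) ∣ Algebra.discr k[X] b := by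
    refine Finset.prod_dvd_of_coprime (fun P hP Q hQ hPQ => ?_) fun P hP =>
      pow_dvd_discr hg b hxX hxO0 hb1 (hT P hP).1 (hc P hP)
    -- Two points of `T` with the same value `c` would both be zeros of `x - c`, which has only one
    -- away from `O`.
    refine (isCoprime_X_sub_C_of_isUnit_sub ?_).pow
    rw [isUnit_iff_ne_zero, sub_ne_zero]
    intro hcc
    have h1 := ordAt_sub_eq_zero hg b hxX hxO0 (hT P hP).1 (hT Q hQ).1 hPQ.symm (hc P hP)
    rw [hcc, hc Q hQ] at h1
    lia
  have h1 := natDegree_le_of_dvd hdvd hne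
  rw [natDegree_prod _ _ fun P _ => pow_ne_zero _ (X_sub_C_ne_zero _)] at h1
  simp only [natDegree_pow, natDegree_X_sub_C, mul_one, Finset.sum_const, smul_eq_mul] at h1
  exact h1.trans hdeg

end

end SmoothProperCurve

open AlgebraicGeometry CategoryTheory

namespace SmoothProperCurve

variable {k : Type*} [Field k] {C : SmoothProperCurve k} [IsAlgClosed k] {O P : C.Point}

/-! ### Torsion points and total ramification -/

lemma HasValueAt.unique {f : C.FunctionField} {c c' : k} (h : C.HasValueAt P f c)
    (h' : C.HasValueAt P f c') : c = c' := by
  have h1 := Submodule.sub_mem _ (hasValueAt_iff.mp h) (hasValueAt_iff.mp h')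
  rw [sub_sub_sub_cancel_left, ← map_sub] at h1
  by_contra hne
  have := h1 (by simpa [sub_eq_zero] using Ne.symm hne)
  rw [ordAt_algebraMap] at this
  lia

lemma ramificationIndex_of_hasValueAt {x : C.FunctionField} {c : k} (h : C.HasValueAt P x c) :
    C.ramificationIndex x P = C.ordAt P (x - algebraMap k C.FunctionField c) := by
  have hex : ∃ c, C.HasValueAt P x c := ⟨c, h⟩
  rw [ramificationIndex, toP1, dif_pos hex, hex.choose_spec.unique h]
  rfl

lemma ramificationIndex_of_ordAt_neg {x : C.FunctionField} (h : C.ordAt P x < 0) :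
    C.ramificationIndex x P = -C.ordAt P x := by
  have hex : ¬ ∃ c, C.HasValueAt P x c := by
    rintro ⟨c, hc⟩
    have h1 := Submodule.add_mem _ (ordGE_anti zero_le_one (hasValueAt_iff.mp hc))
      (algebraMap_mem_ordGE c P)
    rw [sub_add_cancel, ← isRegularAt_iff_mem, isRegularAt_iff] at h1
    lia
  rw [ramificationIndex, toP1, dif_neg hex, ← ordAt_inv]
  rfl

lemma exists_hasValueAt {x : C.FunctionField} (h : x ∈ C.ordGE P 0) : ∃ c, C.HasValueAt P x c :=
  (exists_sub_mem_ordGE_one h).imp fun _ => hasValueAt_iff.mpr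

/-- A point `P ≠ O` where a function with its only pole at `O`, of order `d`, has ramification
index `d`. -/
lemma ramificationIndex_eq_iff {x : C.FunctionField} (h : x ∈ C.ordGE P 0) {d : ℕ} (hd : 0 < d) :
    C.ramificationIndex x P = d ↔ ∃ c : k, C.ordAt P (x - algebraMap k C.FunctionField c) = d := by
  constructor
  · intro hr
    obtain ⟨c, hc⟩ := exists_hasValueAt h
    exact ⟨c, by rwa [← ramificationIndex_of_hasValueAt hc]⟩
  · rintro ⟨c, hc⟩
    have : C.HasValueAt P x c := hasValueAt_iff.mpr fun _ => by lia
    rwa [ramificationIndex_of_hasValueAt this]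

omit [IsAlgClosed k] in
lemma mem_torsionPoints_iff {n : ℕ} : P ∈ C.torsionPoints O n ↔
    ∃ f : C.FunctionField, f ≠ 0 ∧
      ∀ Q, (n • (Finsupp.single P 1 - Finsupp.single O 1) : C.Divisor) Q = C.ordAt Q f := by
  rw [torsionPoints, Set.mem_ofPred_eq, abelJacobi, ← QuotientAddGroup.mk_nsmul,
    QuotientAddGroup.eq_zero_iff, AddSubgroup.mem_addSubgroupOf]
  rfl

/-- The `d`-torsion points on the curve, for `d` the least positive pole order, are `O` and the
zeros of order `d` of the functions `x - c`. -/
theorem mem_torsionPoints_poleOrder_iff (hg : 1 ≤ C.genus) {x : C.FunctionField}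
    (hx : x ∈ C.regularAway O) (hxO : C.ordAt O x = -(C.poleOrder O 2 : ℤ)) (hP : P ≠ O) :
    P ∈ C.torsionPoints O (C.poleOrder O 2) ↔
      ∃ c : k, C.ordAt P (x - algebraMap k C.FunctionField c) = C.poleOrder O 2 := by
  classical
  set d := C.poleOrder O 2
  have hpos : 0 < d := poleOrder_two_pos hg O
  rw [mem_torsionPoints_iff]
  constructor
  · rintro ⟨f, hf0, hf⟩
    have hfO : C.ordAt O f = -(d : ℤ) := by
      rw [← hf]
      simp [hP]
    have hfP : C.ordAt P f = d := by
      rw [← hf]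
      simp [hP.symm]
    have hfB : f ∈ C.regularAway O := fun Q hQ _ => by
      rw [← hf]
      by_cases hPQ : P = Q <;> simp [hQ.symm, hPQ]
    -- The function `f` has the minimal pole order, so it is affine in `x`; its zero of order `d` is
    -- that of `x + b / a`.
    obtain ⟨a, b, hab⟩ := exists_eq_smul_add hg hx hfB hxO hfO
    have ha : a ≠ 0 := by
      rintro rfl
      rw [hab, zero_smul, zero_add, ordAt_algebraMap] at hfO
      lia
    refine ⟨-(a⁻¹ * b), ?_⟩
    rw [← hfP, ← ordAt_smul ha (x - _), hab, smul_sub, Algebra.smul_def a (algebraMap _ _ _),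
      ← map_mul, mul_neg, mul_inv_cancel_left₀ ha, map_neg, sub_neg_eq_add]
  · rintro ⟨c, hc⟩
    have hxO0 : C.ordAt O x ≠ 0 := by lia
    -- The divisor of `x - c` is compared with `d[P] - d[O]` at `O`, at `P`, and at the remaining
    -- points, where it has neither zero nor pole.
    refine ⟨x - algebraMap k C.FunctionField c,
      fun h0 => notMem_range_algebraMap hxO0 ⟨c, (sub_eq_zero.mp h0).symm⟩, fun Q => ?_⟩
    by_cases hQO : Q = O
    · subst hQO
      have hx0 : x ≠ 0 := by rintro rfl; exact hxO0 (ordAt_zero _)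
      have := (ordAt_add_of_mem (P := Q) (r := -algebraMap k C.FunctionField c) hx0
        (Submodule.neg_mem _ (ordGE_anti (by lia) (algebraMap_mem_ordGE c Q)))).2
      rw [← sub_eq_add_neg] at this
      rw [this, hxO]
      simp [hP]
    by_cases hQP : Q = P
    · subst hQP
      rw [hc]
      simp [Ne.symm hQO]
    · rw [ordAt_sub_eq_zero_of_ne hg hx hpos hxO hP hQO hQP hc]
      simp [Ne.symm hQO, Ne.symm hQP]

end SmoothProperCurve

/-! ### The final count. -/

open SmoothProperCurve in
theorem mainTheorem10 {k : Type*} [Field k] [IsAlgClosed k] (C : SmoothProperCurve k)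
    (hg : 2 ≤ C.genus) (O : C.Point) (d : ℕ) (hd : d = C.poleOrder O 2)
    (x : C.FunctionField) (hx : ∀ P, P ≠ O → C.IsRegularAt P x) (hxO : C.ordAt O x = -(d : ℤ)) :
    C.torsionPoints O d = {P | P ∈ C.ramificationPoints x ∧ C.ramificationIndex x P = d} ∧
      (C.torsionPoints O d).Finite ∧
      ((C.torsionPoints O d).ncard : ℚ) ≤ 2 * ((C.genus : ℚ) + d - 1) / ((d : ℚ) - 1) := by
  classical
  subst hd
  have hg1 : 1 ≤ C.genus := by lia
  have hd2 := two_le_poleOrder_two hg1 O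
  have hxB : x ∈ C.regularAway O := fun P hP => isRegularAt_iff_mem.mp (hx P hP)
  have hO : O ∈ C.torsionPoints O (C.poleOrder O 2) :=
    mem_torsionPoints_iff.mpr ⟨1, one_ne_zero, fun Q => by simp [ordAt_one]⟩
  have hT (T : Finset C.Point) (hT : (T : Set C.Point) ⊆ C.torsionPoints O (C.poleOrder O 2)) :
      T.card * (C.poleOrder O 2 - 1) ≤ 2 * (C.genus + C.poleOrder O 2 - 1) := by
    -- The discriminant only sees points other than `O`; allowing for `O` adds `d - 1` to `2g + d -
    -- 1`, which makes `2(g + d - 1)`.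
    have h1 := card_mul_le hg1 hxB hxO (T.erase O) fun P hP => by
      have hPO := Finset.ne_of_mem_erase hP
      exact ⟨hPO, (mem_torsionPoints_poleOrder_iff hg1 hxB hxO hPO).mp
        (hT (Finset.mem_of_mem_erase hP))⟩
    have h2 : T.card * (C.poleOrder O 2 - 1) ≤
        ((T.erase O).card + 1) * (C.poleOrder O 2 - 1) :=
      Nat.mul_le_mul_right _ (by have := Finset.pred_card_le_card_erase (s := T) (a := O); lia)
    rw [add_mul, one_mul] at h2
    lia
  have hfin : (C.torsionPoints O (C.poleOrder O 2)).Finite := by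
    by_contra h
    -- Since `d - 1 ≥ 1`, a finite subset with one element more than the bound is already
    -- contradictory.
    obtain ⟨T, hTs, hcard⟩ := Set.Infinite.exists_subset_card_eq h
      (2 * (C.genus + C.poleOrder O 2 - 1) + 1)
    have h1 := hT T hTs
    rw [hcard] at h1
    have h2 := Nat.mul_le_mul_left (2 * (C.genus + C.poleOrder O 2 - 1) + 1)
      (show 1 ≤ C.poleOrder O 2 - 1 by lia)
    lia
  refine ⟨?_, hfin, ?_⟩
  · ext P
    rw [Set.mem_ofPred_eq, ramificationPoints, Set.mem_ofPred_eq]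
    by_cases hP : P = O
    · subst hP
      rw [ramificationIndex_of_ordAt_neg (by lia), hxO]
      simp only [hO, true_iff]
      lia
    · rw [mem_torsionPoints_poleOrder_iff hg1 hxB hxO hP,
        ramificationIndex_eq_iff (hxB P hP) (by lia), iff_and_self]
      intro h
      rw [(ramificationIndex_eq_iff (hxB P hP) (by lia)).mpr h]
      exact_mod_cast hd2
  · have hd2' : (2 : ℚ) ≤ C.poleOrder O 2 := by exact_mod_cast hd2
    rw [le_div_iff₀ (by linarith), Set.ncard_eq_toFinset_card _ hfin]
    have h1 := hT hfin.toFinset (by simp)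
    have h2 : ((hfin.toFinset.card * (C.poleOrder O 2 - 1) : ℕ) : ℚ) ≤
        (2 * (C.genus + C.poleOrder O 2 - 1) : ℕ) := by exact_mod_cast h1
    rw [Nat.cast_mul, Nat.cast_mul, Nat.cast_sub (by lia), Nat.cast_sub (by lia), Nat.cast_add] at h2
    simpa using h2
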